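/- Let $E$ be an $n$-dimensional real vector space and $B:E\to E^*$ a symmetric positive definite linear operator, with norms $\|x\|^2=\langle Bx,x\rangle$ on $E$ and $\|s\|_*^2=\langle s,B^{-1}s\rangle$ on $E^*$. Let $f:E\to\mathbb R$ be differentiable with $\|\nabla f(y)-\nabla f(x)\|_*\le L_1\|y-x\|$ for all $x,y\in E$, where $L_1>0$. For $\mu>0$ let $$f_\mu(x)=\frac1\kappa\int_E f(x+\mu u)e^{-\|u\|^2/2}\,du,\qquad \kappa=\int_E e^{-\|u\|^2/2}\,du .$$ (i) For every $\mu>0$, $f_\mu$ is differentiable, $\|\nabla f_\mu(y)-\nabla f_\mu(x)\|_*\le L_1\|y-x\|$ and $|f_\mu(y)-f_\mu(x)-\langle\nabla f_\mu(x),y-x\rangle|\le\frac{L_1}{2}\|y-x\|^2$ for all $x,y\in E$. For (ii) and (iii) assume moreover that $f$ is bounded below and put $f^*=\inf f$. Let $\tilde f:E\to\mathbb R$ be a measurable inexact oracle, $|f(x)-\tilde f(x)|\le\delta$ for all $x$, let $u_0,u_1,\dots$ be i.i.d. standard Gaussian vectors in $E$ (with density $\kappa^{-1}e^{-\|u\|^2/2}$),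 and for given $x_0\in E$ and $h>0$ consider $$x_{k+1}=x_k-h\,B^{-1}g_\mu(x_k,u_k),\qquad g_\mu(x,u)=\frac{\tilde f(x+\mu u)-\tilde f(x)}{\mu}\,Bu .$$ (ii) Let $A_1=L_1/2$, $A_2=0$, $\mu>0$, $D\in(0,1]$ and $h=\frac{D}{80(n+4)A_1}$. Then for all $A_1'\ge L_1$, $A_2'\ge0$ and $N\ge1$ the expectations below are finite and $$\min_{0\le k\le N-1}\mathbb E\|\nabla f_\mu(x_k)\|_*^2\le\frac{320(n+4)A_1(f_\mu(x_0)-f^*)}{ND}+\frac{D}{4(n+4)}\Big(\frac{4\delta^2}{\mu^2}n+L_1^2\mu^2n^3+\frac{\mu^2(A_1')^2}{4}(n+6)^3+\frac{(A_2')^2}{\mu^2}n\Big)+\frac{320(n+4)A_1}{D}\Big(A_2+\frac{\delta^2}{2A_1\mu^2}n+\frac{\delta^2}{\mu^2}n\Big).$$ (iii) There is a constant $c>0$ depending only on $L_1$, and for every $\Delta$ a constant $C>0$ depending only on $L_1$ and $\Delta$, such that the following holds for all $n\ge1$, all $E,B,f$ as above, all $x_0$ with $f(x_0)-f^*\le\Delta$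 and all $\varepsilon>0$. Put $\mu_0=\sqrt{c\,\varepsilon}/n$ and take the step size of (ii) with $A_1=L_1/2$, $D=1$, that is $h=\frac1{40(n+4)L_1}$. For every $\mu\in(0,\mu_0]$, every noise level $\delta\le\mu^2/\sqrt n$ (for $\mu=\mu_0$ this is $\delta\le c\,\varepsilon/n^{5/2}$) and every integer $N\ge C\,n/\varepsilon$, all the expectations below are finite and $$\min_{0\le k\le N-1}\mathbb E\|\nabla f(x_k)\|_*^2\le\varepsilon\qquad\text{and}\qquad\min_{0\le k\le N-1}\mathbb E\|\nabla f_\mu(x_k)\|_*^2\le\varepsilon .$$ Moreover $|f_\mu(x)-f(x)|\le\frac{L_1}{2}\mu^2n$ for all $x\in E$, and for $\mu=\mu_0$ this bound equals $\frac{L_1c}{2}\cdot\frac{\varepsilon}{n}$. -/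

import Mathlib

open MeasureTheory ProbabilityTheory

/-!
Setting.  A finite-dimensional real vector space together with a positive definite operator `B`
from the space to its dual, normed by `‖x‖² = ⟨B x, x⟩`, is the same thing as a finite-dimensional
real inner product space `E`.  The operator `B` is then the Riesz map, and the dual norm
`‖s‖² = ⟨s, B⁻¹ s⟩` is the operator norm on `StrongDual ℝ E`; both facts are checked below.
The gradient of `f` at `x`, an element of the dual space, is `fderiv ℝ f x`.
-/

namespace GaussianSmoothing

section Basic

variable {E : Type*} [NormedAddCommGroup E] [InnerProductSpace ℝ E] [FiniteDimensional ℝ E]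

/-- The operator `B : E → E*` that defines the Euclidean structure of `E`. -/
noncomputable def opB : E ≃ₗᵢ⋆[ℝ] StrongDual ℝ E := InnerProductSpace.toDual ℝ E

theorem norm_sq_eq (x : E) : ‖x‖ ^ 2 = opB x x := by
  simp [opB, InnerProductSpace.toDual_apply_apply]

theorem dual_norm_sq_eq (s : StrongDual ℝ E) : ‖s‖ ^ 2 = s (opB.symm s) := by
  rw [← (opB (E := E)).symm.norm_map s, norm_sq_eq, LinearIsometryEquiv.apply_symm_apply]

/-- `f` is differentiable and its gradient is Lipschitz continuous with constant `L`
(the Hölder condition with exponent `1`). -/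
def HasLipschitzGradient (f : E → ℝ) (L : ℝ) : Prop :=
  Differentiable ℝ f ∧ ∀ x y : E, ‖fderiv ℝ f y - fderiv ℝ f x‖ ≤ L * ‖y - x‖

/-- `ftil` is an inexact zeroth-order oracle for `f` with noise level `δ`. -/
def IsInexactOracle (f ftil : E → ℝ) (δ : ℝ) : Prop :=
  ∀ x : E, |f x - ftil x| ≤ δ

/-- The finite-difference estimate `g_μ(x, u) = ((ftil (x + μ u) - ftil x) / μ) B u` in `E*`. -/
noncomputable def gradEst (ftil : E → ℝ) (μ : ℝ) (x u : E) : StrongDual ℝ E :=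
  ((ftil (x + μ • u) - ftil x) / μ) • opB u

/-- The process `x_{k+1} = x_k - h B⁻¹ g_μ(x_k, u_k)` started at `x₀`, along a sequence `u` of
directions. -/
noncomputable def iter (ftil : E → ℝ) (μ h : ℝ) (x₀ : E) (u : ℕ → E) : ℕ → E
  | 0 => x₀
  | k + 1 => iter ftil μ h x₀ u k - h • opB.symm (gradEst ftil μ (iter ftil μ h x₀ u k) (u k))

variable [MeasurableSpace E] [BorelSpace E]

/-- The normalizing constant `κ = ∫ exp (-‖u‖² / 2) du`. -/
noncomputable def kappa (E : Type*) [NormedAddCommGroup E] [InnerProductSpace ℝ E]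
    [FiniteDimensional ℝ E] [MeasurableSpace E] [BorelSpace E] : ℝ :=
  ∫ u : E, Real.exp (-(‖u‖ ^ 2 / 2))

/-- The Gaussian approximation `f_μ(x) = κ⁻¹ ∫ f (x + μ u) exp (-‖u‖² / 2) du`. -/
noncomputable def smoothed (f : E → ℝ) (μ : ℝ) (x : E) : ℝ :=
  (kappa E)⁻¹ * ∫ u : E, f (x + μ • u) * Real.exp (-(‖u‖ ^ 2 / 2))

/-- The directions `u 0, u 1, …` are independent standard Gaussian vectors of `E`. -/
structure IsIIDGaussian {Ω : Type*} [MeasurableSpace Ω] (u : ℕ → Ω → E) (P : Measure Ω) :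
    Prop where
  indep : iIndepFun u P
  law : ∀ k, HasLaw (u k) (stdGaussian E) P

end Basic

/-- The constant step size `D / (80 (n + 4) A₁)`. -/
noncomputable def stepSize (n A₁ D : ℝ) : ℝ := D / (80 * (n + 4) * A₁)

/-- The general upper bound for `min_{k < N} 𝔼 ‖∇f_μ(x_k)‖²` after `N` steps, for Hölder
exponent `1`, dimension `n`, and initial gap `gap = f_μ(x₀) - f*`. -/
noncomputable def gradBound (n L A₁ A₂ A₁' A₂' μ δ D gap N : ℝ) : ℝ :=
  320 * (n + 4) * A₁ * gap / (N * D)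
    + D / (4 * (n + 4)) *
      (4 * δ ^ 2 / μ ^ 2 * n + 4 * L ^ 2 / (1 + 1) ^ 2 * μ ^ 2 * n ^ 3
        + μ ^ 2 * A₁' ^ 2 / 4 * (n + 6) ^ 3 + A₂' ^ 2 / μ ^ 2 * n)
    + 320 * (n + 4) * A₁ / D *
      (A₂ + δ ^ 2 / (2 * A₁ * μ ^ 2) * n + δ ^ 2 / μ ^ 2 * n)

end GaussianSmoothing

namespace GaussianSmoothing

open scoped InnerProductSpace

section Gaussian

variable {E : Type*} [NormedAddCommGroup E] [InnerProductSpace ℝ E] [FiniteDimensional ℝ E]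
  [MeasurableSpace E] [BorelSpace E]

/-! ### The standard Gaussian measure through its density -/

/-! Stein's identity `integral_inner_mul_stdGaussian` drives the proof. Applied to `u ↦ f (x + μ •
u)`, it shows that the exact finite difference times `u` is an unbiased estimate of the gradient of
`smoothed f μ`; applied to `⟪v, u⟫ (‖u‖²)^k`, it gives every moment needed.

Differentiating under the integral makes the gradient of `smoothed f μ` an average of translates of
the gradient of `f`. It is therefore again `L`-Lipschitz and lies within `L μ √n` of the original
one. One step of the method then obeys the quadratic upper bound for `smoothed f μ`. Taking
expectations, the linear term yields `-h ‖∇f_μ‖²`, while Young's inequality for the noise and the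
second moment of the estimate return at most `7/20` of it when `L h (n + 4) ≤ 1/40`. What remains is
the decrease by `13/20` in `integral_descentMajorant_le`.

Since `x_k` is independent of `u_k`, this estimate integrates along the process
(`integral_smoothed_iter_succ_le`). Telescoping and comparing the minimum with the average gives
`exists_integral_norm_fderiv_sq_le`; the rest compares constants. All integrability comes from
polynomial growth together with finite moments of every order. -/

theorem integrable_exp_neg_norm_sq :
    Integrable (fun u : E ↦ Real.exp (-(‖u‖ ^ 2 / 2))) := by
  have h := GaussianFourier.integrable_cexp_neg_mul_sq_norm_add (V := E) (b := 1 / 2) (by simp) 0 0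
  refine h.re.congr (Filter.Eventually.of_forall fun u ↦ ?_)
  have : (-(1 / 2 : ℂ) * (‖u‖ : ℂ) ^ 2 + 0 * ((inner ℝ (0 : E) u : ℝ) : ℂ))
      = ((-(‖u‖ ^ 2 / 2) : ℝ) : ℂ) := by push_cast; ring
  simp only [this]
  exact Complex.exp_ofReal_re _

theorem kappa_eq : kappa E = (2 * Real.pi) ^ (Module.finrank ℝ E / 2 : ℝ) := by
  have h := GaussianFourier.integral_rexp_neg_mul_sq_norm (V := E) (b := 1 / 2) (by norm_num)
  rw [kappa]
  convert h using 2
  · ext u; ring_nf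
  · ring_nf

theorem kappa_pos : 0 < kappa E := by
  rw [kappa_eq]; positivity

/-- Finite measures with equal characteristic functions coincide, and that of the density is the
Fourier integral of a Gaussian with `b = 1/2`. -/
theorem stdGaussian_eq_withDensity :
    stdGaussian E = (volume : Measure E).withDensity
      fun u ↦ ENNReal.ofReal ((kappa E)⁻¹ * Real.exp (-(‖u‖ ^ 2 / 2))) := by
  have hint := (integrable_exp_neg_norm_sq (E := E)).const_mul (kappa E)⁻¹
  have hk := kappa_pos (E := E)
  have := isFiniteMeasure_withDensity_ofReal hint.2
  refine Measure.ext_of_charFun (funext fun t ↦ ?_)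
  rw [charFun_stdGaussian, charFun_apply, integral_withDensity_eq_integral_toReal_smul
    (by fun_prop) (by simp)]
  have h := GaussianFourier.integral_cexp_neg_mul_sq_norm_add (V := E) (b := 1 / 2)
    (by simp) Complex.I t
  have e : ∀ u : E, (ENNReal.ofReal ((kappa E)⁻¹ * Real.exp (-(‖u‖ ^ 2 / 2)))).toReal •
      Complex.exp (inner ℝ u t * Complex.I) = ((kappa E)⁻¹ : ℂ) *
        Complex.exp (-(1 / 2) * (‖u‖ : ℂ) ^ 2 + Complex.I * inner ℝ t u) := by
    intro u
    rw [ENNReal.toReal_ofReal (by positivity), Complex.real_smul, Complex.exp_add,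
      real_inner_comm]
    push_cast
    ring_nf
  simp_rw [e]
  rw [integral_const_mul, h, kappa_eq, Complex.ofReal_cpow (by positivity)]
  have hne : (2 * Real.pi : ℂ) ^ (Module.finrank ℝ E / 2 : ℂ) ≠ 0 := by
    simp [Complex.cpow_eq_zero_iff, Real.pi_ne_zero]
  have e2 : (Real.pi / (1 / 2) : ℂ) = 2 * Real.pi := by ring
  rw [e2]
  push_cast
  rw [inv_mul_cancel_left₀ hne]
  congr 1
  simp
  ring

theorem integral_stdGaussian {F : Type*} [NormedAddCommGroup F] [NormedSpace ℝ F] (φ : E → F) :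
    ∫ u, φ u ∂stdGaussian E
      = ∫ u, ((kappa E)⁻¹ * Real.exp (-(‖u‖ ^ 2 / 2))) • φ u := by
  have hk := kappa_pos (E := E)
  rw [stdGaussian_eq_withDensity, integral_withDensity_eq_integral_toReal_smul
    (by fun_prop) (by simp)]
  refine integral_congr_ae (Filter.Eventually.of_forall fun u ↦ ?_)
  simp only
  rw [ENNReal.toReal_ofReal (by positivity)]

theorem integrable_stdGaussian_iff (φ : E → ℝ) :
    Integrable φ (stdGaussian E) ↔
      Integrable fun u ↦ ((kappa E)⁻¹ * Real.exp (-(‖u‖ ^ 2 / 2))) * φ u := by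
  have hk := kappa_pos (E := E)
  rw [stdGaussian_eq_withDensity, integrable_withDensity_iff_integrable_smul'
    (by fun_prop) (by simp)]
  refine integrable_congr (Filter.Eventually.of_forall fun u ↦ ?_)
  simp only
  rw [ENNReal.toReal_ofReal (by positivity), smul_eq_mul]

theorem smoothed_eq_integral (f : E → ℝ) (μ : ℝ) (x : E) :
    smoothed f μ x = ∫ u, f (x + μ • u) ∂stdGaussian E := by
  rw [integral_stdGaussian, smoothed, ← integral_const_mul]
  refine integral_congr_ae (Filter.Eventually.of_forall fun u ↦ ?_)
  simp only [smul_eq_mul]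
  ring

theorem integrable_norm_pow (m : ℕ) : Integrable (fun u : E ↦ ‖u‖ ^ m) (stdGaussian E) := by
  rcases eq_or_ne m 0 with rfl | hm
  · simp
  · exact (IsGaussian.memLp_id (stdGaussian E) m (by simp)).integrable_norm_pow hm

theorem integrable_one_add_norm_pow (m : ℕ) :
    Integrable (fun u : E ↦ (1 + ‖u‖) ^ m) (stdGaussian E) := by
  have : (fun u : E ↦ (1 + ‖u‖) ^ m) =
      fun u ↦ ∑ k ∈ Finset.range (m + 1), ‖u‖ ^ k * (m.choose k : ℝ) := by
    ext u; rw [add_comm, add_pow]; simp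
  rw [this]
  exact integrable_finsetSum _ fun k _ ↦ (integrable_norm_pow k).mul_const _

/-- A continuous function of polynomial growth is integrable for the Gaussian measure. -/
theorem integrable_of_growth {F : Type*} [NormedAddCommGroup F] {φ : E → F}
    (hφ : AEStronglyMeasurable φ (stdGaussian E)) (C : ℝ) (m : ℕ)
    (h : ∀ u, ‖φ u‖ ≤ C * (1 + ‖u‖) ^ m) :
    Integrable φ (stdGaussian E) :=
  ((integrable_one_add_norm_pow m).const_mul C).mono' hφ (Filter.Eventually.of_forall h)

/-- **Stein's identity** for the standard Gaussian measure. -/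
theorem integral_inner_mul_stdGaussian {φ : E → ℝ} (v : E) (hd : Differentiable ℝ φ)
    (h₀ : Integrable φ (stdGaussian E))
    (h₁ : Integrable (fun u ↦ ⟪v, u⟫_ℝ * φ u) (stdGaussian E))
    (h₂ : Integrable (fun u ↦ fderiv ℝ φ u v) (stdGaussian E)) :
    ∫ u, ⟪v, u⟫_ℝ * φ u ∂stdGaussian E = ∫ u, fderiv ℝ φ u v ∂stdGaussian E := by
  set g : E → ℝ := fun u ↦ (kappa E)⁻¹ * Real.exp (-(‖u‖ ^ 2 / 2)) with hg
  have hgd : ∀ u, HasFDerivAt g (-(g u) • innerSL ℝ u) u := by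
    intro u
    have h1 : HasFDerivAt (fun u : E ↦ ‖u‖ ^ 2) (2 • (innerSL ℝ u)) u :=
      (hasStrictFDerivAt_norm_sq u).hasFDerivAt
    have h2 : HasFDerivAt (fun u : E ↦ -(‖u‖ ^ 2 / 2)) (-innerSL ℝ u) u := by
      convert! (h1.mul_const (1 / 2 : ℝ)).neg using 1
      · ext u; simp [div_eq_mul_inv]
      · ext w; simp
    convert! h2.exp.const_mul (kappa E)⁻¹ using 1
    ext w; simp [hg]; ring
  have hfg : ∀ u, fderiv ℝ g u v = -(g u * ⟪v, u⟫_ℝ) := by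
    intro u; rw [(hgd u).fderiv]; simp [real_inner_comm]
  rw [integrable_stdGaussian_iff] at h₀ h₁ h₂
  have e₀ : ∀ u, (kappa E)⁻¹ * Real.exp (-(‖u‖ ^ 2 / 2)) * φ u = φ u * g u := fun u ↦ by
    simp only [hg]; ring
  have e₁ : ∀ u, (kappa E)⁻¹ * Real.exp (-(‖u‖ ^ 2 / 2)) * (⟪v, u⟫_ℝ * φ u)
      = -(φ u * fderiv ℝ g u v) := fun u ↦ by
    rw [hfg]; simp only [hg]; ring
  have e₂ : ∀ u, (kappa E)⁻¹ * Real.exp (-(‖u‖ ^ 2 / 2)) * fderiv ℝ φ u v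
      = fderiv ℝ φ u v * g u := fun u ↦ by
    simp only [hg]; ring
  simp_rw [e₀] at h₀
  simp_rw [e₁] at h₁
  simp_rw [e₂] at h₂
  rw [integral_stdGaussian, integral_stdGaussian]
  simp_rw [smul_eq_mul, e₁, e₂]
  -- Integration by parts against Lebesgue measure: the derivative of the density `g` in direction
  -- `v` is `-⟪v, u⟫ g u`.
  rw [integral_neg, integral_mul_fderiv_eq_neg_fderiv_mul_of_integrable h₂
    (by simpa using h₁.neg) h₀ (fun x _ ↦ hd x) (fun x _ ↦ (hgd x).differentiableAt), neg_neg]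

/-! ### Moments of the standard Gaussian measure -/

/-- Stein's identity for `⟪v, u⟫ (‖u‖²)^k`. For `k = 0` the truncated exponent `k - 1` is harmless
because its coefficient vanishes. -/
theorem integral_inner_sq_mul_norm_sq_pow (v : E) (k : ℕ) :
    ∫ u, ⟪v, u⟫_ℝ ^ 2 * (‖u‖ ^ 2) ^ k ∂stdGaussian E
      = ‖v‖ ^ 2 * ∫ u : E, (‖u‖ ^ 2) ^ k ∂stdGaussian E
        + 2 * k * ∫ u, ⟪v, u⟫_ℝ ^ 2 * (‖u‖ ^ 2) ^ (k - 1) ∂stdGaussian E := by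
  have hd : ∀ u : E, HasFDerivAt (fun u : E ↦ ⟪v, u⟫_ℝ * (‖u‖ ^ 2) ^ k)
      (⟪v, u⟫_ℝ • ((k * (‖u‖ ^ 2) ^ (k - 1)) • (2 • innerSL ℝ u))
        + (‖u‖ ^ 2) ^ k • innerSL ℝ v) u := by
    intro u
    have h1 : HasFDerivAt (fun u : E ↦ ‖u‖ ^ 2) (2 • (innerSL ℝ u)) u :=
      (hasStrictFDerivAt_norm_sq u).hasFDerivAt
    convert! (innerSL ℝ v).hasFDerivAt.mul (h1.pow k) using 1
    ext w; simp
  have hcs : ∀ u : E, |⟪v, u⟫_ℝ| ≤ ‖v‖ * (1 + ‖u‖) := fun u ↦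
    (abs_real_inner_le_norm v u).trans (by gcongr; linarith)
  have hpow : ∀ (u : E) (j : ℕ), (‖u‖ ^ 2) ^ j ≤ (1 + ‖u‖) ^ (2 * j) := fun u j ↦ by
    rw [pow_mul]; gcongr; linarith
  have i₂ : ∀ j : ℕ, Integrable (fun u : E ↦ ⟪v, u⟫_ℝ ^ 2 * (‖u‖ ^ 2) ^ j) (stdGaussian E) := by
    intro j
    refine integrable_of_growth (by fun_prop) (‖v‖ ^ 2) (2 + 2 * j) fun u ↦ ?_
    rw [Real.norm_eq_abs, abs_mul, abs_pow, abs_of_nonneg (by positivity : 0 ≤ (‖u‖ ^ 2) ^ j),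
      pow_add, ← mul_assoc, ← mul_pow]
    exact mul_le_mul (pow_le_pow_left₀ (abs_nonneg _) (hcs u) 2) (hpow u j) (by positivity)
      (by positivity)
  have i₀ : Integrable (fun u : E ↦ (‖u‖ ^ 2) ^ k) (stdGaussian E) := by
    simpa only [← pow_mul] using integrable_norm_pow (E := E) (2 * k)
  have hdv : ∀ u : E, fderiv ℝ (fun u : E ↦ ⟪v, u⟫_ℝ * (‖u‖ ^ 2) ^ k) u v
      = ‖v‖ ^ 2 * (‖u‖ ^ 2) ^ k + 2 * k * (⟪v, u⟫_ℝ ^ 2 * (‖u‖ ^ 2) ^ (k - 1)) := by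
    intro u
    rw [(hd u).fderiv]
    simp [real_inner_comm u v]
    ring
  have hS := integral_inner_mul_stdGaussian v (fun u ↦ (hd u).differentiableAt) ?_ ?_ ?_
  · simp_rw [hdv] at hS
    rw [integral_add (i₀.const_mul _) ((i₂ _).const_mul _), integral_const_mul,
      integral_const_mul] at hS
    rw [← hS]
    congr 1; ext u; ring
  · refine integrable_of_growth (by fun_prop) ‖v‖ (1 + 2 * k) fun u ↦ ?_
    rw [Real.norm_eq_abs, abs_mul, abs_of_nonneg (by positivity : 0 ≤ (‖u‖ ^ 2) ^ k),
      pow_add, ← mul_assoc, pow_one]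
    exact mul_le_mul (hcs u) (hpow u k) (by positivity) (by positivity)
  · exact (i₂ k).congr (.of_forall fun u ↦ by simp only; ring)
  · simp_rw [hdv]
    exact (i₀.const_mul _).add ((i₂ _).const_mul _)

theorem integrable_inner_sq_mul_norm_pow (v : E) (j : ℕ) :
    Integrable (fun u : E ↦ ⟪v, u⟫_ℝ ^ 2 * ‖u‖ ^ j) (stdGaussian E) := by
  refine integrable_of_growth (by fun_prop) (‖v‖ ^ 2) (2 + j) fun u ↦ ?_
  rw [Real.norm_eq_abs, abs_mul, abs_pow, abs_of_nonneg (by positivity : 0 ≤ ‖u‖ ^ j),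
    pow_add, ← mul_assoc, ← mul_pow]
  have h := abs_real_inner_le_norm v u
  gcongr
  · refine h.trans ?_
    gcongr; linarith
  · linarith

/-- Sum the preceding recursion over an orthonormal basis: the terms `‖v‖²` add up to the dimension
and the squares `⟪v, u⟫²` to `‖u‖²`. -/
theorem integral_norm_pow_add_two (k : ℕ) :
    ∫ u : E, ‖u‖ ^ (2 * (k + 1)) ∂stdGaussian E
      = (Module.finrank ℝ E + 2 * k) * ∫ u : E, ‖u‖ ^ (2 * k) ∂stdGaussian E := by
  set b := stdOrthonormalBasis ℝ E
  have hb : ∀ u : E, ∑ i, ⟪b i, u⟫_ℝ ^ 2 = ‖u‖ ^ 2 := fun u ↦ by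
    simpa using b.sum_sq_norm_inner_right u
  have hsum : ∀ j : ℕ, ∑ i, ∫ u, ⟪b i, u⟫_ℝ ^ 2 * (‖u‖ ^ 2) ^ j ∂stdGaussian E
      = ∫ u : E, ‖u‖ ^ (2 * (j + 1)) ∂stdGaussian E := by
    intro j
    rw [← integral_finsetSum]
    · congr 1; ext u
      rw [← Finset.sum_mul, hb]; ring
    · intro i _
      simpa only [← pow_mul] using integrable_inner_sq_mul_norm_pow (b i) (2 * j)
  rw [← hsum k]
  rw [Finset.sum_congr rfl fun i _ ↦ integral_inner_sq_mul_norm_sq_pow (b i) k]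
  rw [Finset.sum_add_distrib, ← Finset.mul_sum, hsum]
  simp only [OrthonormalBasis.norm_eq_one, one_pow, one_mul, Finset.sum_const, Finset.card_univ,
    Fintype.card_fin, nsmul_eq_mul, ← pow_mul]
  rcases k with _ | k
  · simp
  · simp only [Nat.add_sub_cancel]; ring

theorem integral_norm_sq : ∫ u : E, ‖u‖ ^ 2 ∂stdGaussian E = Module.finrank ℝ E := by
  simpa using integral_norm_pow_add_two (E := E) 0

theorem integral_norm_pow_four :
    ∫ u : E, ‖u‖ ^ 4 ∂stdGaussian E
      = Module.finrank ℝ E * (Module.finrank ℝ E + 2) := by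
  have := integral_norm_pow_add_two (E := E) 1
  norm_num [integral_norm_sq] at this
  rw [this]; ring

theorem integral_norm_pow_six :
    ∫ u : E, ‖u‖ ^ 6 ∂stdGaussian E
      = Module.finrank ℝ E * (Module.finrank ℝ E + 2) * (Module.finrank ℝ E + 4) := by
  have := integral_norm_pow_add_two (E := E) 2
  norm_num [integral_norm_pow_four] at this
  rw [this]; ring

theorem integral_inner_sq_mul_norm_sq (v : E) :
    ∫ u, ⟪v, u⟫_ℝ ^ 2 * ‖u‖ ^ 2 ∂stdGaussian E = (Module.finrank ℝ E + 2) * ‖v‖ ^ 2 := by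
  have h₀ := integral_inner_sq_mul_norm_sq_pow v 0
  have h₁ := integral_inner_sq_mul_norm_sq_pow v 1
  simp at h₀
  simp [integral_norm_sq, h₀] at h₁
  rw [h₁]; ring

end Gaussian

section Smooth

variable {E : Type*} [NormedAddCommGroup E] [InnerProductSpace ℝ E] {f : E → ℝ} {L : ℝ}

theorem integrable_const_add_mul_norm [FiniteDimensional ℝ E] [MeasurableSpace E] [BorelSpace E]
    (a b : ℝ) : Integrable (fun u : E ↦ a + b * ‖u‖) (stdGaussian E) := by
  have h := (integrable_norm_pow (E := E) 1).const_mul b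
  simp only [pow_one] at h
  exact (integrable_const a).add h

/-! ### Functions with Lipschitz gradient -/

namespace HasLipschitzGradient

theorem continuous (hf : HasLipschitzGradient f L) : Continuous f := hf.1.continuous

theorem continuous_fderiv (hf : HasLipschitzGradient f L) : Continuous (fderiv ℝ f) := by
  refine (LipschitzWith.of_dist_le' (K := L) fun x y ↦ ?_).continuous
  rw [dist_eq_norm, dist_eq_norm]
  exact hf.2 y x

/-- Along the segment, the remainder has derivative at most `L ‖d‖² t` in absolute value, so it
stays below the boundary function `L / 2 ‖d‖² t²`. -/
theorem abs_sub_sub_fderiv_le (hf : HasLipschitzGradient f L) (x y : E) :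
    |f y - f x - fderiv ℝ f x (y - x)| ≤ L / 2 * ‖y - x‖ ^ 2 := by
  set d := y - x with hd
  have hder : ∀ t : ℝ, HasDerivAt (fun t : ℝ ↦ f (x + t • d) - f x - t * fderiv ℝ f x d)
      (fderiv ℝ f (x + t • d) d - fderiv ℝ f x d) t := by
    intro t
    have h1 : HasDerivAt (fun t : ℝ ↦ x + t • d) d t := by
      simpa using ((hasDerivAt_id t).smul_const d).const_add x
    have h2 := (hf.1 (x + t • d)).hasFDerivAt.comp_hasDerivAt t h1
    have h3 := (h2.sub_const (f x)).fun_sub ((hasDerivAt_id t).mul_const (fderiv ℝ f x d))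
    simpa using h3
  have hB : ∀ t : ℝ, HasDerivAt (fun t : ℝ ↦ L / 2 * ‖d‖ ^ 2 * t ^ 2) (L * ‖d‖ ^ 2 * t) t := by
    intro t
    convert! ((hasDerivAt_pow 2 t).const_mul (L / 2 * ‖d‖ ^ 2)) using 1
    simp; ring
  have key := image_norm_le_of_norm_deriv_right_le_deriv_boundary (a := 0) (b := 1)
    (fun t _ ↦ (hder t).continuousAt.continuousWithinAt)
    (fun t _ ↦ (hder t).hasDerivWithinAt) (by simp) hB ?_ (Set.right_mem_Icc.2 zero_le_one)
  · simpa [hd] using key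
  · intro t ht
    rw [← sub_apply]
    refine (ContinuousLinearMap.le_opNorm _ _).trans ?_
    have h := hf.2 x (x + t • d)
    rw [add_sub_cancel_left, norm_smul, Real.norm_of_nonneg ht.1] at h
    calc _ ≤ L * (t * ‖d‖) * ‖d‖ := by gcongr
      _ = _ := by ring

theorem abs_add_smul_sub_le (hf : HasLipschitzGradient f L) (μ : ℝ) (x u : E) :
    |f (x + μ • u) - f x - μ * fderiv ℝ f x u| ≤ L / 2 * μ ^ 2 * ‖u‖ ^ 2 := by
  have h := hf.abs_sub_sub_fderiv_le x (x + μ • u)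
  rw [add_sub_cancel_left, map_smul, smul_eq_mul, norm_smul, mul_pow, Real.norm_eq_abs,
    sq_abs, ← mul_assoc] at h
  exact h

theorem abs_add_smul_le (hf : HasLipschitzGradient f L) (hL : 0 ≤ L) (μ : ℝ) (x u : E) :
    |f (x + μ • u)| ≤
      (|f x| + |μ| * ‖fderiv ℝ f x‖ + L / 2 * μ ^ 2) * (1 + ‖u‖) ^ 2 := by
  have h := hf.abs_add_smul_sub_le μ x u
  have h1 : |μ * fderiv ℝ f x u| ≤ |μ| * (‖fderiv ℝ f x‖ * ‖u‖) := by
    rw [abs_mul]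
    exact mul_le_mul_of_nonneg_left ((fderiv ℝ f x).le_opNorm u) (abs_nonneg _)
  have h2 : |f (x + μ • u)| ≤ |f x| + |μ| * (‖fderiv ℝ f x‖ * ‖u‖) + L / 2 * μ ^ 2 * ‖u‖ ^ 2 := by
    have e : f (x + μ • u) = f x + μ * fderiv ℝ f x u
      + (f (x + μ • u) - f x - μ * fderiv ℝ f x u) := by ring
    rw [e]
    refine (abs_add_three _ _ _).trans ?_
    gcongr
  refine h2.trans ?_
  have hu := norm_nonneg u
  have a1 : (1 : ℝ) ≤ (1 + ‖u‖) ^ 2 := by nlinarith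
  have a2 : ‖u‖ ≤ (1 + ‖u‖) ^ 2 := by nlinarith
  have a3 : ‖u‖ ^ 2 ≤ (1 + ‖u‖) ^ 2 := by nlinarith
  rw [add_mul, add_mul, ← mul_assoc]
  gcongr
  exact le_mul_of_one_le_right (abs_nonneg _) a1

theorem norm_fderiv_add_smul_le (hf : HasLipschitzGradient f L) (μ : ℝ) (x u : E) :
    ‖fderiv ℝ f (x + μ • u)‖ ≤ ‖fderiv ℝ f x‖ + L * |μ| * ‖u‖ := by
  have h := hf.2 x (x + μ • u)
  rw [add_sub_cancel_left, norm_smul, Real.norm_eq_abs, ← mul_assoc] at h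
  have := norm_sub_norm_le (fderiv ℝ f (x + μ • u)) (fderiv ℝ f x)
  linarith

/-! ### Gaussian smoothing of a function with Lipschitz gradient. -/

variable [FiniteDimensional ℝ E] [MeasurableSpace E] [BorelSpace E]

theorem integrable_add_smul (hf : HasLipschitzGradient f L) (hL : 0 ≤ L) (μ : ℝ) (x : E) :
    Integrable (fun u ↦ f (x + μ • u)) (stdGaussian E) :=
  integrable_of_growth (hf.continuous.comp (by fun_prop)).aestronglyMeasurable _ 2
    (hf.abs_add_smul_le hL μ x)

theorem integrable_fderiv_add_smul (hf : HasLipschitzGradient f L) (μ : ℝ) (x : E) :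
    Integrable (fun u ↦ fderiv ℝ f (x + μ • u)) (stdGaussian E) := by
  have hc : Continuous fun u ↦ fderiv ℝ f (x + μ • u) := hf.continuous_fderiv.comp (by fun_prop)
  refine Integrable.mono' (integrable_const_add_mul_norm ‖fderiv ℝ f x‖ (L * |μ|))
    hc.aestronglyMeasurable (.of_forall (hf.norm_fderiv_add_smul_le μ x))

theorem hasFDerivAt_smoothed (hf : HasLipschitzGradient f L) (hL : 0 ≤ L) (μ : ℝ) (x : E) :
    HasFDerivAt (smoothed f μ) (∫ u, fderiv ℝ f (x + μ • u) ∂stdGaussian E) x := by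
  have e : smoothed f μ = fun x ↦ ∫ u, f (x + μ • u) ∂stdGaussian E :=
    funext (smoothed_eq_integral f μ)
  rw [e]
  have hc : ∀ x, Continuous fun u ↦ fderiv ℝ f (x + μ • u) := fun x ↦
    hf.continuous_fderiv.comp (by fun_prop)
  -- On the unit ball around `x` the gradient moves by at most `L`, which accounts for the middle
  -- term of the dominating function.
  refine hasFDerivAt_integral_of_dominated_of_fderiv_le (Metric.ball_mem_nhds x one_pos)
    (bound := fun u ↦ ‖fderiv ℝ f x‖ + L + L * |μ| * ‖u‖)
    (F' := fun x u ↦ fderiv ℝ f (x + μ • u))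
    (.of_forall fun y ↦ (hf.integrable_add_smul hL μ y).aestronglyMeasurable)
    (hf.integrable_add_smul hL μ x) (hc x).aestronglyMeasurable
    (.of_forall fun u y hy ↦ ?_) ?_ (.of_forall fun u y _ ↦ ?_)
  · refine (hf.norm_fderiv_add_smul_le μ y u).trans ?_
    have h1 := hf.2 x y
    have h2 := norm_sub_norm_le (fderiv ℝ f y) (fderiv ℝ f x)
    have h3 : ‖y - x‖ ≤ 1 := by rw [← dist_eq_norm]; exact (Metric.mem_ball.1 hy).le
    nlinarith
  · exact integrable_const_add_mul_norm _ _
  · exact HasFDerivAt.comp y (hf.1 (y + μ • u)).hasFDerivAt ((hasFDerivAt_id y).add_const (μ • u))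

theorem fderiv_smoothed (hf : HasLipschitzGradient f L) (hL : 0 ≤ L) (μ : ℝ) (x : E) :
    fderiv ℝ (smoothed f μ) x = ∫ u, fderiv ℝ f (x + μ • u) ∂stdGaussian E :=
  (hf.hasFDerivAt_smoothed hL μ x).fderiv

theorem hasLipschitzGradient_smoothed (hf : HasLipschitzGradient f L) (hL : 0 ≤ L) (μ : ℝ) :
    HasLipschitzGradient (smoothed f μ) L := by
  refine ⟨fun x ↦ (hf.hasFDerivAt_smoothed hL μ x).differentiableAt, fun x y ↦ ?_⟩
  rw [hf.fderiv_smoothed hL, hf.fderiv_smoothed hL, ← integral_sub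
    (hf.integrable_fderiv_add_smul μ y) (hf.integrable_fderiv_add_smul μ x)]
  refine (norm_integral_le_of_norm_le_const (C := L * ‖y - x‖) (.of_forall fun u ↦ ?_)).trans ?_
  · simpa using hf.2 (x + μ • u) (y + μ • u)
  · simp

/-- The linear term of the Taylor expansion has mean zero, so only the quadratic remainder survives,
with `𝔼 ‖u‖² = n`. -/
theorem abs_smoothed_sub_le (hf : HasLipschitzGradient f L) (hL : 0 ≤ L) (μ : ℝ) (x : E) :
    |smoothed f μ x - f x| ≤ L / 2 * μ ^ 2 * Module.finrank ℝ E := by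
  have hlin : Integrable (fun u ↦ fderiv ℝ f x u) (stdGaussian E) :=
    (fderiv ℝ f x).integrable_comp IsGaussian.integrable_id
  have e : smoothed f μ x - f x
      = ∫ u, (f (x + μ • u) - f x - μ * fderiv ℝ f x u) ∂stdGaussian E := by
    have hi := hf.integrable_add_smul hL μ x
    rw [integral_sub (f := fun u ↦ f (x + μ • u) - f x) (hi.sub (integrable_const _))
      (hlin.const_mul μ), integral_sub hi (integrable_const _),
      integral_const_mul, integral_strongDual_stdGaussian, smoothed_eq_integral]
    simp
  rw [e, ← integral_norm_sq (E := E), ← integral_const_mul]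
  rw [← Real.norm_eq_abs]
  exact norm_integral_le_of_norm_le ((integrable_norm_pow 2).const_mul _)
    (.of_forall fun u ↦ hf.abs_add_smul_sub_le μ x u)

theorem norm_fderiv_smoothed_sub_sq_le (hf : HasLipschitzGradient f L) (hL : 0 ≤ L) (μ : ℝ)
    (x : E) :
    ‖fderiv ℝ (smoothed f μ) x - fderiv ℝ f x‖ ^ 2
      ≤ L ^ 2 * μ ^ 2 * Module.finrank ℝ E := by
  have i1 : Integrable (fun u : E ↦ ‖u‖) (stdGaussian E) := by
    simpa using integrable_norm_pow (E := E) 1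
  have h : ‖fderiv ℝ (smoothed f μ) x - fderiv ℝ f x‖
      ≤ L * |μ| * ∫ u : E, ‖u‖ ∂stdGaussian E := by
    have e : fderiv ℝ (smoothed f μ) x - fderiv ℝ f x
        = ∫ u, (fderiv ℝ f (x + μ • u) - fderiv ℝ f x) ∂stdGaussian E := by
      rw [integral_sub (hf.integrable_fderiv_add_smul μ x) (integrable_const _),
        hf.fderiv_smoothed hL]
      simp
    rw [e, ← integral_const_mul]
    refine norm_integral_le_of_norm_le (i1.const_mul _) (.of_forall fun u ↦ ?_)
    have h := hf.2 x (x + μ • u)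
    rwa [add_sub_cancel_left, norm_smul, Real.norm_eq_abs, ← mul_assoc] at h
  -- The variance of `‖u‖` is nonnegative and its second moment is `n`.
  have hm : (∫ u : E, ‖u‖ ∂stdGaussian E) ^ 2 ≤ Module.finrank ℝ E := by
    set m := ∫ u : E, ‖u‖ ∂stdGaussian E with hm
    have h0 : 0 ≤ ∫ u : E, (‖u‖ ^ 2 - 2 * m * ‖u‖ + m ^ 2) ∂stdGaussian E :=
      integral_nonneg fun u ↦ by
        have := sq_nonneg (‖u‖ - m)
        simp only [Pi.zero_apply]; linarith
    rw [integral_add (f := fun u : E ↦ ‖u‖ ^ 2 - 2 * m * ‖u‖) ((integrable_norm_pow 2).sub (i1.const_mul _)) (integrable_const _),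
      integral_sub (integrable_norm_pow 2) (i1.const_mul _), integral_norm_sq,
      integral_const_mul, ← hm] at h0
    simp only [integral_const, probReal_univ, one_smul] at h0
    linarith
  calc _ ≤ (L * |μ| * ∫ u : E, ‖u‖ ∂stdGaussian E) ^ 2 := by gcongr
    _ = L ^ 2 * μ ^ 2 * (∫ u : E, ‖u‖ ∂stdGaussian E) ^ 2 := by
      rw [mul_pow, mul_pow, sq_abs]
    _ ≤ _ := by gcongr

theorem norm_fderiv_sq_le (hf : HasLipschitzGradient f L) (hL : 0 ≤ L) (μ : ℝ) (x : E) :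
    ‖fderiv ℝ f x‖ ^ 2 ≤ 2 * ‖fderiv ℝ (smoothed f μ) x‖ ^ 2
      + 2 * (L ^ 2 * μ ^ 2 * Module.finrank ℝ E) := by
  have h1 := hf.norm_fderiv_smoothed_sub_sq_le hL μ x
  set g := fderiv ℝ (smoothed f μ) x with hg
  have h2 : ‖fderiv ℝ f x‖ ≤ ‖g‖ + ‖g - fderiv ℝ f x‖ := by
    have := norm_sub_norm_le (fderiv ℝ f x) g
    rw [norm_sub_rev] at this
    linarith
  have h3 : ‖fderiv ℝ f x‖ ^ 2 ≤ (‖g‖ + ‖g - fderiv ℝ f x‖) ^ 2 := by gcongr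
  nlinarith [sq_nonneg (‖g‖ - ‖g - fderiv ℝ f x‖)]

theorem integrable_inner_mul_add_smul (hf : HasLipschitzGradient f L) (hL : 0 ≤ L) (μ : ℝ)
    (x v : E) : Integrable (fun u ↦ ⟪v, u⟫_ℝ * f (x + μ • u)) (stdGaussian E) := by
  have hc : Continuous fun u ↦ f (x + μ • u) := hf.continuous.comp (by fun_prop)
  refine integrable_of_growth
    ((by fun_prop : Continuous fun u ↦ ⟪v, u⟫_ℝ).mul hc).aestronglyMeasurable
    (‖v‖ * (|f x| + |μ| * ‖fderiv ℝ f x‖ + L / 2 * μ ^ 2)) 3 fun u ↦ ?_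
  rw [norm_mul]
  have h1 : ‖⟪v, u⟫_ℝ‖ ≤ ‖v‖ * (1 + ‖u‖) :=
    (norm_inner_le_norm v u).trans (by gcongr; linarith)
  calc _ ≤ (‖v‖ * (1 + ‖u‖)) *
        ((|f x| + |μ| * ‖fderiv ℝ f x‖ + L / 2 * μ ^ 2) * (1 + ‖u‖) ^ 2) :=
      mul_le_mul h1 (hf.abs_add_smul_le hL μ x u) (abs_nonneg _) (by positivity)
    _ = _ := by ring

/-- Stein's identity, the chain rule contributing the factor `μ`. Since `u` is centred, this is also
the mean of the finite difference tested against `v`. -/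
theorem integral_inner_mul_add_smul (hf : HasLipschitzGradient f L) (hL : 0 ≤ L) (μ : ℝ)
    (x v : E) :
    ∫ u, ⟪v, u⟫_ℝ * f (x + μ • u) ∂stdGaussian E
      = μ * fderiv ℝ (smoothed f μ) x v := by
  have hd : ∀ u, HasFDerivAt (fun u ↦ f (x + μ • u)) (μ • fderiv ℝ f (x + μ • u)) u := by
    intro u
    have h1 : HasFDerivAt (fun u : E ↦ x + μ • u) (μ • ContinuousLinearMap.id ℝ E) u :=
      ((hasFDerivAt_id u).const_smul μ).const_add x
    convert! (hf.1 (x + μ • u)).hasFDerivAt.comp u h1 using 1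
    ext w; simp
  have hdv : ∀ u, fderiv ℝ (fun u ↦ f (x + μ • u)) u v = μ * fderiv ℝ f (x + μ • u) v := by
    intro u; rw [(hd u).fderiv]; rfl
  have hi := hf.integrable_fderiv_add_smul μ x
  rw [integral_inner_mul_stdGaussian v (fun u ↦ (hd u).differentiableAt)
    (hf.integrable_add_smul hL μ x) (hf.integrable_inner_mul_add_smul hL μ x v)]
  · simp_rw [hdv]
    rw [integral_const_mul, hf.fderiv_smoothed hL, ContinuousLinearMap.integral_apply hi]
  · simp_rw [hdv]
    exact (hi.apply_continuousLinearMap v).const_mul μ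

theorem iInf_le_smoothed (hf : HasLipschitzGradient f L) (hL : 0 ≤ L)
    (hb : BddBelow (Set.range f)) (μ : ℝ) (x : E) :
    ⨅ y, f y ≤ smoothed f μ x := by
  rw [smoothed_eq_integral]
  calc ⨅ y, f y = ∫ _, ⨅ y, f y ∂stdGaussian E := by simp
    _ ≤ _ := integral_mono (integrable_const _) (hf.integrable_add_smul hL μ x)
      fun u ↦ ciInf_le hb _

end HasLipschitzGradient

end Smooth

/-! ### Polynomial growth -/

/-- The norm of `φ` is bounded by a polynomial in the norm of its argument. -/
def PolyGrowth {H F : Type*} [NormedAddCommGroup H] [NormedAddCommGroup F] (φ : H → F) : Prop :=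
  ∃ (C : ℝ) (m : ℕ), 0 ≤ C ∧ ∀ z, ‖φ z‖ ≤ C * (1 + ‖z‖) ^ m

namespace PolyGrowth

variable {H F K : Type*} [NormedAddCommGroup H] [NormedAddCommGroup F] [NormedAddCommGroup K]

theorem of_le {φ : H → F} {ψ : H → K} (hψ : PolyGrowth ψ) (h : ∀ z, ‖φ z‖ ≤ ‖ψ z‖) :
    PolyGrowth φ := by
  obtain ⟨C, m, hC, hm⟩ := hψ
  exact ⟨C, m, hC, fun z ↦ (h z).trans (hm z)⟩

theorem const (c : F) : PolyGrowth fun _ : H ↦ c :=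
  ⟨‖c‖, 0, norm_nonneg c, fun z ↦ by simp⟩

theorem id : PolyGrowth fun z : H ↦ z :=
  ⟨1, 1, zero_le_one, fun z ↦ by simp⟩

theorem fst : PolyGrowth fun z : H × K ↦ z.1 :=
  of_le id fun z ↦ norm_fst_le z

theorem snd : PolyGrowth fun z : H × K ↦ z.2 :=
  of_le id fun z ↦ norm_snd_le z

theorem add {φ ψ : H → F} (hφ : PolyGrowth φ) (hψ : PolyGrowth ψ) :
    PolyGrowth fun z ↦ φ z + ψ z := by
  obtain ⟨C, m, hC, hm⟩ := hφ
  obtain ⟨D, k, hD, hk⟩ := hψ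
  refine ⟨C + D, max m k, by positivity, fun z ↦ (norm_add_le _ _).trans ?_⟩
  have h1 : (1 : ℝ) ≤ 1 + ‖z‖ := by linarith [norm_nonneg z]
  rw [add_mul]
  refine add_le_add ((hm z).trans ?_) ((hk z).trans ?_) <;> gcongr <;>
    first | exact h1 | exact le_max_left _ _ | exact le_max_right _ _

/-- The common source of the rules for products, scalar multiples and evaluation of functionals. -/
theorem mul_of_le {φ : H → F} {α β : H → ℝ} (hα : PolyGrowth α) (hβ : PolyGrowth β)
    (h : ∀ z, ‖φ z‖ ≤ ‖α z‖ * ‖β z‖) : PolyGrowth φ := by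
  obtain ⟨C, m, hC, hm⟩ := hα
  obtain ⟨D, k, hD, hk⟩ := hβ
  refine ⟨C * D, m + k, by positivity, fun z ↦ (h z).trans ?_⟩
  calc ‖α z‖ * ‖β z‖ ≤ (C * (1 + ‖z‖) ^ m) * (D * (1 + ‖z‖) ^ k) :=
      mul_le_mul (hm z) (hk z) (norm_nonneg _) (by positivity)
    _ = _ := by ring

theorem norm {φ : H → F} (hφ : PolyGrowth φ) : PolyGrowth fun z ↦ ‖φ z‖ :=
  of_le hφ fun z ↦ by simp

theorem neg {φ : H → F} (hφ : PolyGrowth φ) : PolyGrowth fun z ↦ -φ z :=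
  of_le hφ fun z ↦ by simp

theorem sub {φ ψ : H → F} (hφ : PolyGrowth φ) (hψ : PolyGrowth ψ) :
    PolyGrowth fun z ↦ φ z - ψ z := by
  simpa only [sub_eq_add_neg] using hφ.add hψ.neg

theorem mul {φ ψ : H → ℝ} (hφ : PolyGrowth φ) (hψ : PolyGrowth ψ) :
    PolyGrowth fun z ↦ φ z * ψ z :=
  mul_of_le hφ hψ fun z ↦ by simp

theorem smul [NormedSpace ℝ F] {α : H → ℝ} {ψ : H → F} (hα : PolyGrowth α)
    (hψ : PolyGrowth ψ) : PolyGrowth fun z ↦ α z • ψ z :=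
  mul_of_le hα hψ.norm fun z ↦ by simp [norm_smul]

theorem const_mul {φ : H → ℝ} (hφ : PolyGrowth φ) (c : ℝ) : PolyGrowth fun z ↦ c * φ z :=
  (const c).mul hφ

theorem const_smul [NormedSpace ℝ F] {ψ : H → F} (hψ : PolyGrowth ψ) (c : ℝ) :
    PolyGrowth fun z ↦ c • ψ z :=
  (const c).smul hψ

theorem pow {φ : H → ℝ} (hφ : PolyGrowth φ) (k : ℕ) : PolyGrowth fun z ↦ φ z ^ k := by
  induction k with
  | zero => simpa using const (1 : ℝ)
  | succ k ih => simpa only [pow_succ] using ih.mul hφ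

theorem apply [NormedSpace ℝ F] {φ : H → StrongDual ℝ F} {ψ : H → F} (hφ : PolyGrowth φ)
    (hψ : PolyGrowth ψ) : PolyGrowth fun z ↦ φ z (ψ z) :=
  mul_of_le hφ.norm hψ.norm fun z ↦ by simpa using (φ z).le_opNorm (ψ z)

theorem comp {φ : F → K} {ψ : H → F} (hφ : PolyGrowth φ) (hψ : PolyGrowth ψ) :
    PolyGrowth fun z ↦ φ (ψ z) := by
  obtain ⟨C, m, hC, hm⟩ := hφ
  have h : PolyGrowth fun z ↦ C * (1 + ‖ψ z‖) ^ m := (((const 1).add hψ.norm).pow m).const_mul C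
  refine of_le h fun z ↦ (hm _).trans (le_abs_self _)

theorem integrable {Ω : Type*} [MeasurableSpace Ω] {P : Measure Ω} {Z : Ω → H} {φ : H → F}
    (hφ : PolyGrowth φ) (hmeas : AEStronglyMeasurable (fun ω ↦ φ (Z ω)) P)
    (hZ : ∀ m : ℕ, Integrable (fun ω ↦ (1 + ‖Z ω‖) ^ m) P) :
    Integrable (fun ω ↦ φ (Z ω)) P := by
  obtain ⟨C, m, -, hm⟩ := hφ
  exact ((hZ m).const_mul C).mono' hmeas (.of_forall fun ω ↦ hm _)

end PolyGrowth

/-! ### Expected decrease of the smoothed function in one step. -/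

section Descent

variable {E : Type*} [NormedAddCommGroup E] [InnerProductSpace ℝ E] {f : E → ℝ} {L : ℝ}

theorem HasLipschitzGradient.polyGrowth (hf : HasLipschitzGradient f L) (hL : 0 ≤ L) :
    PolyGrowth f := by
  refine ⟨|f 0| + |1| * ‖fderiv ℝ f 0‖ + L / 2 * 1 ^ 2, 2, by positivity, fun z ↦ ?_⟩
  have h := hf.abs_add_smul_le hL 1 0 z
  rwa [zero_add, one_smul] at h

theorem HasLipschitzGradient.polyGrowth_fderiv (hf : HasLipschitzGradient f L) :
    PolyGrowth (fderiv ℝ f) := by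
  have h : PolyGrowth fun z : E ↦ ‖fderiv ℝ f 0‖ + L * ‖z‖ :=
    (PolyGrowth.const _).add (PolyGrowth.id.norm.const_mul L)
  refine h.of_le fun z ↦ ?_
  have h2 := hf.norm_fderiv_add_smul_le 1 0 z
  rw [zero_add, one_smul, abs_one, mul_one] at h2
  exact h2.trans (le_abs_self _)

variable [FiniteDimensional ℝ E] [MeasurableSpace E] [BorelSpace E]

/-- A continuous upper bound for the value of the smoothed function after one step from `z.1`
in the direction `z.2`. -/
noncomputable def descentMajorant (f : E → ℝ) (L μ δ h : ℝ) (z : E × E) : ℝ :=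
  smoothed f μ z.1 - h / μ * ((f (z.1 + μ • z.2) - f z.1) * fderiv ℝ (smoothed f μ) z.1 z.2)
    + h * (‖fderiv ℝ (smoothed f μ) z.1‖ ^ 2 / 4 + 4 * δ ^ 2 / μ ^ 2 * ‖z.2‖ ^ 2)
    + L * h ^ 2 / 2 * (4 * (fderiv ℝ f z.1 z.2 ^ 2 * ‖z.2‖ ^ 2) + L ^ 2 * μ ^ 2 * ‖z.2‖ ^ 6
      + 8 * δ ^ 2 / μ ^ 2 * ‖z.2‖ ^ 2)

theorem continuous_descentMajorant (hf : HasLipschitzGradient f L) (hL : 0 ≤ L) (μ δ h : ℝ) :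
    Continuous (descentMajorant f L μ δ h) := by
  have h1 := hf.continuous
  have h2 := hf.continuous_fderiv
  have h3 := (hf.hasLipschitzGradient_smoothed hL μ).continuous
  have h4 := (hf.hasLipschitzGradient_smoothed hL μ).continuous_fderiv
  unfold descentMajorant
  fun_prop

theorem polyGrowth_descentMajorant (hf : HasLipschitzGradient f L) (hL : 0 ≤ L) (μ δ h : ℝ) :
    PolyGrowth (descentMajorant f L μ δ h) := by
  have h1 := hf.polyGrowth hL
  have h2 := hf.polyGrowth_fderiv
  have h3 := (hf.hasLipschitzGradient_smoothed hL μ).polyGrowth hL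
  have h4 := (hf.hasLipschitzGradient_smoothed hL μ).polyGrowth_fderiv
  have x : PolyGrowth fun z : E × E ↦ z.1 := .fst
  have u : PolyGrowth fun z : E × E ↦ z.2 := .snd
  have g : PolyGrowth fun z : E × E ↦ ‖fderiv ℝ (smoothed f μ) z.1‖ ^ 2 / 4 := by
    simpa only [div_eq_inv_mul] using ((h4.comp x).norm.pow 2).const_mul 4⁻¹
  exact (((h3.comp x).sub ((((h1.comp (x.add (u.const_smul μ))).sub (h1.comp x)).mul
    ((h4.comp x).apply u)).const_mul _)).add ((g.add ((u.norm.pow 2).const_mul _)).const_mul h)).add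
    ((((((h2.comp x).apply u).pow 2).mul (u.norm.pow 2)).const_mul 4 |>.add
      ((u.norm.pow 6).const_mul _) |>.add ((u.norm.pow 2).const_mul _)).const_mul _)

/-- The quadratic upper bound for `smoothed f μ`, with the oracle's quotient `q` replaced by the
exact quotient `p` at a cost of `2 δ / μ`. The oracle is only measurable; the resulting bound
involves `f` alone and is continuous. -/
theorem smoothed_step_le_descentMajorant (hf : HasLipschitzGradient f L) (hL : 0 ≤ L)
    {ftil : E → ℝ} {μ δ h : ℝ} (hft : IsInexactOracle f ftil δ) (hμ : 0 < μ) (hh : 0 ≤ h)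
    (x u : E) :
    smoothed f μ (x - h • opB.symm (gradEst ftil μ x u)) ≤ descentMajorant f L μ δ h (x, u) := by
  set q := (ftil (x + μ • u) - ftil x) / μ with hq
  set p := (f (x + μ • u) - f x) / μ with hp
  set g := fderiv ℝ (smoothed f μ) x with hg
  have hstep : opB.symm (gradEst ftil μ x u) = q • u := by
    rw [gradEst, ← hq]
    simp [opB]
  have hqp : |q - p| ≤ 2 * δ / μ := by
    have e : q - p = ((f x - ftil x) - (f (x + μ • u) - ftil (x + μ • u))) / μ := by
      rw [hq, hp]; ring
    rw [e, abs_div, abs_of_pos hμ]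
    gcongr
    have := abs_sub (f x - ftil x) (f (x + μ • u) - ftil (x + μ • u))
    linarith [hft x, hft (x + μ • u)]
  have hpd : |p - fderiv ℝ f x u| ≤ L / 2 * μ * ‖u‖ ^ 2 := by
    have e : p - fderiv ℝ f x u = (f (x + μ • u) - f x - μ * fderiv ℝ f x u) / μ := by
      rw [hp]; field_simp
    rw [e, abs_div, abs_of_pos hμ, div_le_iff₀ hμ]
    exact (hf.abs_add_smul_sub_le μ x u).trans_eq (by ring)
  -- Apply `(a + b)² ≤ 2a² + 2b²` twice, splitting `q` into directional derivative, Taylor remainder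
  -- and noise.
  have hq2 : q ^ 2 * ‖u‖ ^ 2 ≤ 4 * (fderiv ℝ f x u ^ 2 * ‖u‖ ^ 2) + L ^ 2 * μ ^ 2 * ‖u‖ ^ 6
      + 8 * δ ^ 2 / μ ^ 2 * ‖u‖ ^ 2 := by
    have h1 : (q - p) ^ 2 ≤ (2 * δ / μ) ^ 2 := sq_le_sq' (neg_le_of_abs_le hqp) (le_of_abs_le hqp)
    have h2 : (p - fderiv ℝ f x u) ^ 2 ≤ (L / 2 * μ * ‖u‖ ^ 2) ^ 2 :=
      sq_le_sq' (neg_le_of_abs_le hpd) (le_of_abs_le hpd)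
    have h3 : q ^ 2 ≤ 2 * p ^ 2 + 2 * (q - p) ^ 2 := by nlinarith [sq_nonneg (2 * p - q)]
    have h4 : p ^ 2 ≤ 2 * fderiv ℝ f x u ^ 2 + 2 * (p - fderiv ℝ f x u) ^ 2 := by
      nlinarith [sq_nonneg (2 * fderiv ℝ f x u - p)]
    have h5 : q ^ 2 ≤ 4 * fderiv ℝ f x u ^ 2 + 4 * (L / 2 * μ * ‖u‖ ^ 2) ^ 2
      + 2 * (2 * δ / μ) ^ 2 := by linarith
    calc q ^ 2 * ‖u‖ ^ 2 ≤ _ * ‖u‖ ^ 2 := mul_le_mul_of_nonneg_right h5 (by positivity)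
      _ = _ := by ring
  -- Young's inequality, weighted so that the noise costs only a quarter of `‖g‖²`.
  have hcross : -(q * g u) ≤ -(p * g u) + (‖g‖ ^ 2 / 4 + 4 * δ ^ 2 / μ ^ 2 * ‖u‖ ^ 2) := by
    have h1 : -((q - p) * g u) ≤ (2 * δ / μ) * (‖g‖ * ‖u‖) := by
      refine (neg_le_abs _).trans ?_
      rw [abs_mul]
      exact mul_le_mul hqp (g.le_opNorm u) (abs_nonneg _) ((abs_nonneg _).trans hqp)
    have h2 := sq_nonneg (‖g‖ / 2 - 2 * δ / μ * ‖u‖)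
    have e : (‖g‖ / 2 - 2 * δ / μ * ‖u‖) ^ 2 = ‖g‖ ^ 2 / 4 + 4 * δ ^ 2 / μ ^ 2 * ‖u‖ ^ 2
      - (2 * δ / μ) * (‖g‖ * ‖u‖) := by ring
    linarith
  have hquad := (hf.hasLipschitzGradient_smoothed hL μ).abs_sub_sub_fderiv_le x (x - h • q • u)
  have e1 : x - h • q • u - x = (-(h * q)) • u := by rw [smul_smul, neg_smul]; abel
  rw [e1, map_smul, ← hg, norm_smul, mul_pow, Real.norm_eq_abs, sq_abs, smul_eq_mul] at hquad
  have hup := le_of_abs_le hquad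
  have a1 := mul_le_mul_of_nonneg_left hcross hh
  have a2 := mul_le_mul_of_nonneg_left hq2 (by positivity : 0 ≤ L * h ^ 2 / 2)
  rw [hstep]
  have e2 : descentMajorant f L μ δ h (x, u) = smoothed f μ x - h * (p * g u)
    + h * (‖g‖ ^ 2 / 4 + 4 * δ ^ 2 / μ ^ 2 * ‖u‖ ^ 2)
    + L * h ^ 2 / 2 * (4 * (fderiv ℝ f x u ^ 2 * ‖u‖ ^ 2) + L ^ 2 * μ ^ 2 * ‖u‖ ^ 6
      + 8 * δ ^ 2 / μ ^ 2 * ‖u‖ ^ 2) := by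
    simp only [descentMajorant, hp, hg]; ring
  rw [e2]
  nlinarith

theorem integral_descentMajorant (hf : HasLipschitzGradient f L) (hL : 0 ≤ L) {μ : ℝ}
    (hμ : 0 < μ) (δ h : ℝ) (x : E) :
    ∫ u, descentMajorant f L μ δ h (x, u) ∂stdGaussian E
      = smoothed f μ x - h * ‖fderiv ℝ (smoothed f μ) x‖ ^ 2
        + h * (‖fderiv ℝ (smoothed f μ) x‖ ^ 2 / 4 + 4 * δ ^ 2 / μ ^ 2 * Module.finrank ℝ E)
        + L * h ^ 2 / 2 * (4 * ((Module.finrank ℝ E + 2) * ‖fderiv ℝ f x‖ ^ 2)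
          + L ^ 2 * μ ^ 2 *
            (Module.finrank ℝ E * (Module.finrank ℝ E + 2) * (Module.finrank ℝ E + 4))
          + 8 * δ ^ 2 / μ ^ 2 * Module.finrank ℝ E) := by
  have hB : ∀ (s : StrongDual ℝ E) (u : E), ⟪opB.symm s, u⟫_ℝ = s u := fun s u ↦
    InnerProductSpace.toDual_symm_apply
  set g := fderiv ℝ (smoothed f μ) x with hg
  have iq : ∀ c : ℝ, Integrable (fun u : E ↦ c * ‖u‖ ^ 2) (stdGaussian E) := fun c ↦
    (integrable_norm_pow 2).const_mul c
  have iq6 : ∀ c : ℝ, Integrable (fun u : E ↦ c * ‖u‖ ^ 6) (stdGaussian E) := fun c ↦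
    (integrable_norm_pow 6).const_mul c
  -- Testing against `B⁻¹ g` turns the cross term into the squared dual norm of `g`.
  have hv := hf.integral_inner_mul_add_smul hL μ x (opB.symm g)
  have iv := hf.integrable_inner_mul_add_smul hL μ x (opB.symm g)
  have hw := integral_inner_sq_mul_norm_sq (opB.symm (fderiv ℝ f x))
  have iw := integrable_inner_sq_mul_norm_pow (opB.symm (fderiv ℝ f x)) 2
  simp_rw [hB] at hv iv hw iw
  rw [← dual_norm_sq_eq, ← hg] at hv
  rw [LinearIsometryEquiv.norm_map] at hw
  have hlin : Integrable (fun u ↦ g u) (stdGaussian E) :=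
    g.integrable_comp IsGaussian.integrable_id
  have ic : Integrable (fun u ↦ (f (x + μ • u) - f x) * g u) (stdGaussian E) := by
    refine (iv.sub (hlin.const_mul (f x))).congr (.of_forall fun u ↦ ?_)
    simp only [Pi.sub_apply]; ring
  have hc : ∫ u, (f (x + μ • u) - f x) * g u ∂stdGaussian E = μ * ‖g‖ ^ 2 := by
    have e : ∀ u, (f (x + μ • u) - f x) * g u = g u * f (x + μ • u) - f x * g u := fun u ↦ by ring
    simp_rw [e]
    rw [integral_sub iv (hlin.const_mul _), integral_const_mul, integral_strongDual_stdGaussian,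
      hv, mul_zero, sub_zero]
  have i1 : Integrable (fun u ↦ smoothed f μ x - h / μ * ((f (x + μ • u) - f x) * g u))
      (stdGaussian E) := (integrable_const _).sub (ic.const_mul _)
  have i2 : Integrable (fun u : E ↦ h * (‖g‖ ^ 2 / 4 + 4 * δ ^ 2 / μ ^ 2 * ‖u‖ ^ 2))
      (stdGaussian E) := ((integrable_const _).add (iq _)).const_mul h
  have i3 : Integrable (fun u : E ↦ 4 * (fderiv ℝ f x u ^ 2 * ‖u‖ ^ 2)
      + L ^ 2 * μ ^ 2 * ‖u‖ ^ 6) (stdGaussian E) := (iw.const_mul 4).add (iq6 _)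
  have i4 : Integrable (fun u : E ↦ L * h ^ 2 / 2 * (4 * (fderiv ℝ f x u ^ 2 * ‖u‖ ^ 2)
      + L ^ 2 * μ ^ 2 * ‖u‖ ^ 6 + 8 * δ ^ 2 / μ ^ 2 * ‖u‖ ^ 2)) (stdGaussian E) :=
    (i3.add (iq _)).const_mul _
  have i12 : Integrable (fun u ↦ smoothed f μ x - h / μ * ((f (x + μ • u) - f x) * g u)
      + h * (‖g‖ ^ 2 / 4 + 4 * δ ^ 2 / μ ^ 2 * ‖u‖ ^ 2)) (stdGaussian E) := i1.add i2
  simp only [descentMajorant]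
  rw [← hg, integral_add i12 i4, integral_add i1 i2,
    integral_sub (integrable_const _) (ic.const_mul _), integral_const_mul, hc,
    integral_const_mul, integral_add (integrable_const _) (iq _), integral_const_mul,
    integral_const_mul, integral_add i3 (iq _), integral_add (iw.const_mul 4) (iq6 _),
    integral_const_mul, integral_const_mul, integral_const_mul, hw, integral_norm_sq,
    integral_norm_pow_six]
  simp only [integral_const, probReal_univ, one_smul]
  field_simp

/-- The expected decrease in one step is at least `13 h / 20` times the squared gradient norm,
up to `h` times this error. -/
noncomputable def descentError (n L μ δ h : ℝ) : ℝ :=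
  4 * δ ^ 2 / μ ^ 2 * n + L * h / 2 * (8 * (n + 2) * (L ^ 2 * μ ^ 2 * n)
    + L ^ 2 * μ ^ 2 * (n * (n + 2) * (n + 4)) + 8 * δ ^ 2 / μ ^ 2 * n)

theorem integral_descentMajorant_le (hf : HasLipschitzGradient f L) (hL : 0 ≤ L) {μ h : ℝ}
    (hμ : 0 < μ) (hh : 0 ≤ h) (δ : ℝ) (hLh : L * h * (Module.finrank ℝ E + 4) ≤ 1 / 40) (x : E) :
    ∫ u, descentMajorant f L μ δ h (x, u) ∂stdGaussian E
      ≤ smoothed f μ x - 13 / 20 * h * ‖fderiv ℝ (smoothed f μ) x‖ ^ 2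
        + h * descentError (Module.finrank ℝ E) L μ δ h := by
  rw [integral_descentMajorant hf hL hμ, descentError]
  set n : ℝ := (Module.finrank ℝ E : ℝ) with hn
  have hn0 : 0 ≤ n := Nat.cast_nonneg _
  set g := fderiv ℝ (smoothed f μ) x with hg
  have hnf := hf.norm_fderiv_sq_le hL μ x
  rw [← hn, ← hg] at hnf
  have b1 : L * h ^ 2 / 2 * (4 * ((n + 2) * ‖fderiv ℝ f x‖ ^ 2)) ≤
      L * h ^ 2 / 2 * (4 * ((n + 2) * (2 * ‖g‖ ^ 2 + 2 * (L ^ 2 * μ ^ 2 * n)))) := by gcongr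
  -- The second moment thus costs `h / 10` times `‖g‖²`; with the quarter lost to noise, `1 - 1/4 -
  -- 1/10 = 13/20`.
  have b2 : h * (L * h * (n + 2)) * (4 * ‖g‖ ^ 2) ≤ h * (1 / 40) * (4 * ‖g‖ ^ 2) := by
    gcongr
    refine le_trans ?_ hLh
    gcongr
    norm_num
  nlinarith

end Descent

/-! ### The random process -/

section Iteration

theorem polyGrowth_of_isInexactOracle {E : Type*} [NormedAddCommGroup E] {f ftil : E → ℝ} {δ : ℝ} (hf : PolyGrowth f)
    (hft : IsInexactOracle f ftil δ) : PolyGrowth ftil := by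
  refine (hf.norm.add (.const |δ|)).of_le fun x ↦ ?_
  rw [Real.norm_eq_abs, Real.norm_of_nonneg (by positivity), Real.norm_eq_abs]
  have h1 := abs_sub_abs_le_abs_sub (ftil x) (f x)
  rw [abs_sub_comm] at h1
  linarith [hft x, le_abs_self δ]

variable {E : Type*} [NormedAddCommGroup E] [InnerProductSpace ℝ E] [FiniteDimensional ℝ E]

theorem iter_succ (ftil : E → ℝ) (μ h : ℝ) (x₀ : E) (u : ℕ → E) (k : ℕ) :
    iter ftil μ h x₀ u (k + 1) = iter ftil μ h x₀ u k
      - h • opB.symm (gradEst ftil μ (iter ftil μ h x₀ u k) (u k)) := rfl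

theorem symm_gradEst (ftil : E → ℝ) (μ : ℝ) (x u : E) :
    opB.symm (gradEst ftil μ x u) = ((ftil (x + μ • u) - ftil x) / μ) • u := by
  simp [gradEst, opB]

theorem iter_congr (ftil : E → ℝ) (μ h : ℝ) (x₀ : E) {u v : ℕ → E} {k : ℕ}
    (huv : ∀ j < k, u j = v j) : iter ftil μ h x₀ u k = iter ftil μ h x₀ v k := by
  induction k with
  | zero => rfl
  | succ k ih =>
    rw [iter_succ, iter_succ, ih fun j hj ↦ huv j (hj.trans k.lt_succ_self),
      huv k k.lt_succ_self]

variable [MeasurableSpace E] [BorelSpace E]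

theorem measurable_iter {ftil : E → ℝ} (hft : Measurable ftil) (μ h : ℝ) (x₀ : E) (k : ℕ) :
    Measurable fun u : ℕ → E ↦ iter ftil μ h x₀ u k := by
  induction k with
  | zero => exact measurable_const
  | succ k ih =>
    have hk : Measurable fun u : ℕ → E ↦ u k := measurable_pi_apply k
    simp_rw [iter_succ, symm_gradEst]
    fun_prop

variable {Ω : Type*} [MeasurableSpace Ω] {P : Measure Ω} {u : ℕ → Ω → E}

theorem IsIIDGaussian.aemeasurable_iter (hu : IsIIDGaussian u P) {ftil : E → ℝ}
    (hft : Measurable ftil) (μ h : ℝ) (x₀ : E) (k : ℕ) :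
    AEMeasurable (fun ω ↦ iter ftil μ h x₀ (fun j ↦ u j ω) k) P :=
  (measurable_iter hft μ h x₀ k).comp_aemeasurable
    (aemeasurable_pi_lambda _ fun j ↦ (hu.law j).aemeasurable)

/-- The `k`-th iterate is a measurable function of the directions with index below `k`. -/
theorem IsIIDGaussian.indepFun_iter (hu : IsIIDGaussian u P) {ftil : E → ℝ}
    (hft : Measurable ftil) (μ h : ℝ) (x₀ : E) (k : ℕ) :
    IndepFun (fun ω ↦ iter ftil μ h x₀ (fun j ↦ u j ω) k) (u k) P := by
  have h1 := hu.indep.indepFun_finset₀ (Finset.range k) {k} (by simp)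
    fun j ↦ (hu.law j).aemeasurable
  -- Padding the first `k` directions by zeros gives a full sequence with the same `k`-th iterate,
  -- by `iter_congr`.
  let ext : (Finset.range k → E) → ℕ → E := fun w j ↦
    if hj : j ∈ Finset.range k then w ⟨j, hj⟩ else 0
  have hext : Measurable ext := by
    refine measurable_pi_lambda _ fun j ↦ ?_
    by_cases hj : j ∈ Finset.range k
    · simpa only [ext, hj, dite_true] using measurable_pi_apply _
    · simp only [ext, hj, dite_false, measurable_const]
  have h2 := h1.comp ((measurable_iter hft μ h x₀ k).comp hext)
    (measurable_pi_apply (⟨k, by simp⟩ : ({k} : Finset ℕ)))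
  have e : (fun ω ↦ iter ftil μ h x₀ (fun j ↦ u j ω) k)
      = ((fun u ↦ iter ftil μ h x₀ u k) ∘ ext) ∘ fun a (i : Finset.range k) ↦ u i a := by
    ext1 ω
    refine iter_congr ftil μ h x₀ fun j hj ↦ ?_
    simp [ext, hj]
  rw [e]
  exact h2

/-- The sup norm gives `1 + max a b ≤ (1 + a)(1 + b)`, and a product of independent integrable
variables is integrable. -/
theorem integrable_one_add_norm_prodMk_pow {X U : Ω → E}
    (hX : ∀ m : ℕ, Integrable (fun ω ↦ (1 + ‖X ω‖) ^ m) P) (hXm : AEMeasurable X P)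
    (hU : HasLaw U (stdGaussian E) P) (hXU : IndepFun X U P) (m : ℕ) :
    Integrable (fun ω ↦ (1 + ‖(X ω, U ω)‖) ^ m) P := by
  have hU' : Integrable (fun ω ↦ (1 + ‖U ω‖) ^ m) P := by
    have h := integrable_one_add_norm_pow (E := E) m
    rw [← hU.map_eq, integrable_map_measure (by fun_prop) hU.aemeasurable] at h
    exact h
  have hme : Measurable fun x : E ↦ (1 + ‖x‖) ^ m := by fun_prop
  have hprod := (hXU.comp hme hme).integrable_mul (hX m) hU'
  have hUm := hU.aemeasurable
  refine hprod.mono' ?_ (.of_forall fun ω ↦ ?_)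
  · exact ((hXm.prodMk hUm).norm.const_add 1 |>.pow_const m).aestronglyMeasurable
  · simp only [Pi.mul_apply, Function.comp_apply]
    rw [Real.norm_of_nonneg (by positivity), ← mul_pow]
    refine pow_le_pow_left₀ (by positivity) ?_ m
    rw [Prod.norm_def]
    have h1 := norm_nonneg (X ω)
    have h2 := norm_nonneg (U ω)
    rcases max_cases ‖X ω‖ ‖U ω‖ with ⟨h, -⟩ | ⟨h, -⟩ <;> rw [h] <;> nlinarith

variable [IsProbabilityMeasure P]

/-- By independence the joint law is a product measure, so Fubini applies; this replaces
conditioning on the past. -/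
theorem integral_comp_of_indepFun_stdGaussian {X U : Ω → E} (hX : AEMeasurable X P)
    (hU : HasLaw U (stdGaussian E) P) (hXU : IndepFun X U P) {Φ : E × E → ℝ} (hΦ : Continuous Φ)
    (hi : Integrable (fun ω ↦ Φ (X ω, U ω)) P) :
    Integrable (fun ω ↦ ∫ v, Φ (X ω, v) ∂stdGaussian E) P ∧
      ∫ ω, Φ (X ω, U ω) ∂P = ∫ ω, ∫ v, Φ (X ω, v) ∂stdGaussian E ∂P := by
  have hmap := (indepFun_iff_map_prod_eq_prod_map_map hX hU.aemeasurable).1 hXU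
  rw [hU.map_eq] at hmap
  have hXm : IsProbabilityMeasure (P.map X) := Measure.isProbabilityMeasure_map hX
  have hp : AEMeasurable (fun ω ↦ (X ω, U ω)) P := hX.prodMk hU.aemeasurable
  have hi' : Integrable Φ ((P.map X).prod (stdGaussian E)) := by
    rw [← hmap, integrable_map_measure hΦ.aestronglyMeasurable hp]
    exact hi
  have hm : AEStronglyMeasurable (fun x ↦ ∫ v, Φ (x, v) ∂stdGaussian E) (P.map X) :=
    hi'.integral_prod_left.aestronglyMeasurable
  constructor
  · exact (integrable_map_measure hm hX).1 hi'.integral_prod_left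
  · rw [← integral_map hX hm, ← integral_prod _ hi', ← hmap,
      integral_map hp hΦ.aestronglyMeasurable]

/-- All exponents `m` must be handled together in the induction on `k`: a step is polynomially
bounded in `(x_k, u_k)`, so a moment of `x_{k+1}` may require a higher one of `x_k`. -/
theorem IsIIDGaussian.integrable_one_add_norm_iter_pow (hu : IsIIDGaussian u P) {ftil : E → ℝ}
    (hft : Measurable ftil) (hg : PolyGrowth ftil) (μ h : ℝ) (x₀ : E) (k : ℕ) :
    ∀ m : ℕ, Integrable (fun ω ↦ (1 + ‖iter ftil μ h x₀ (fun j ↦ u j ω) k‖) ^ m) P := by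
  induction k with
  | zero => intro m; exact integrable_const ((1 + ‖x₀‖) ^ m)
  | succ k ih =>
    intro m
    have hm := hu.aemeasurable_iter hft μ h x₀ (k + 1)
    have hz := integrable_one_add_norm_prodMk_pow ih (hu.aemeasurable_iter hft μ h x₀ k)
      (hu.law k) (hu.indepFun_iter hft μ h x₀ k)
    have x : PolyGrowth fun z : E × E ↦ z.1 := .fst
    have v : PolyGrowth fun z : E × E ↦ z.2 := .snd
    have hφ : PolyGrowth fun z : E × E ↦
        (1 + ‖z.1 - h • ((μ⁻¹ * (ftil (z.1 + μ • z.2) - ftil z.1)) • z.2)‖) ^ m :=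
      ((PolyGrowth.const 1).add (x.sub (((((hg.comp (x.add (v.const_smul μ))).sub
        (hg.comp x)).const_mul μ⁻¹).smul v).const_smul h)).norm).pow m
    have e : ∀ ω, iter ftil μ h x₀ (fun j ↦ u j ω) (k + 1)
        = iter ftil μ h x₀ (fun j ↦ u j ω) k
          - h • ((μ⁻¹ * (ftil (iter ftil μ h x₀ (fun j ↦ u j ω) k + μ • u k ω)
            - ftil (iter ftil μ h x₀ (fun j ↦ u j ω) k))) • u k ω) := fun ω ↦ by
      rw [iter_succ, symm_gradEst, div_eq_inv_mul]
    have hme : AEStronglyMeasurable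
        (fun ω ↦ (1 + ‖iter ftil μ h x₀ (fun j ↦ u j ω) (k + 1)‖) ^ m) P :=
      (hm.norm.const_add 1 |>.pow_const m).aestronglyMeasurable
    simp_rw [e] at hme ⊢
    exact hφ.integrable hme hz

theorem IsIIDGaussian.integrable_comp_iter (hu : IsIIDGaussian u P) {ftil : E → ℝ}
    (hft : Measurable ftil) (hg : PolyGrowth ftil) (μ h : ℝ) (x₀ : E) (k : ℕ) {φ : E → ℝ}
    (hφ : Continuous φ) (hφg : PolyGrowth φ) :
    Integrable (fun ω ↦ φ (iter ftil μ h x₀ (fun j ↦ u j ω) k)) P :=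
  hφg.integrable
    (hφ.measurable.comp_aemeasurable (hu.aemeasurable_iter hft μ h x₀ k)).aestronglyMeasurable
    (hu.integrable_one_add_norm_iter_pow hft hg μ h x₀ k)

variable {f ftil : E → ℝ} {L μ δ h : ℝ}

theorem integrable_norm_fderiv_iter_sq (hf : HasLipschitzGradient f L) (hL : 0 ≤ L)
    (ho : IsInexactOracle f ftil δ) (hft : Measurable ftil) (hu : IsIIDGaussian u P)
    {φ : E → ℝ} (hφ : HasLipschitzGradient φ L) (x₀ : E) (k : ℕ) :
    Integrable (fun ω ↦ ‖fderiv ℝ φ (iter ftil μ h x₀ (fun j ↦ u j ω) k)‖ ^ 2) P :=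
  hu.integrable_comp_iter hft (polyGrowth_of_isInexactOracle (hf.polyGrowth hL) ho) μ h x₀ k
    (hφ.continuous_fderiv.norm.pow 2) (hφ.polyGrowth_fderiv.norm.pow 2)

theorem integrable_smoothed_iter (hf : HasLipschitzGradient f L) (hL : 0 ≤ L)
    (ho : IsInexactOracle f ftil δ) (hft : Measurable ftil) (hu : IsIIDGaussian u P)
    (x₀ : E) (k : ℕ) :
    Integrable (fun ω ↦ smoothed f μ (iter ftil μ h x₀ (fun j ↦ u j ω) k)) P :=
  hu.integrable_comp_iter hft (polyGrowth_of_isInexactOracle (hf.polyGrowth hL) ho) μ h x₀ k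
    (hf.hasLipschitzGradient_smoothed hL μ).continuous
    ((hf.hasLipschitzGradient_smoothed hL μ).polyGrowth hL)

theorem integral_smoothed_iter_succ_le (hf : HasLipschitzGradient f L) (hL : 0 ≤ L)
    (ho : IsInexactOracle f ftil δ) (hft : Measurable ftil) (hu : IsIIDGaussian u P)
    (hμ : 0 < μ) (hh : 0 ≤ h) (hLh : L * h * (Module.finrank ℝ E + 4) ≤ 1 / 40)
    (x₀ : E) (k : ℕ) :
    ∫ ω, smoothed f μ (iter ftil μ h x₀ (fun j ↦ u j ω) (k + 1)) ∂P
      ≤ ∫ ω, smoothed f μ (iter ftil μ h x₀ (fun j ↦ u j ω) k) ∂P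
        - 13 / 20 * h *
          ∫ ω, ‖fderiv ℝ (smoothed f μ) (iter ftil μ h x₀ (fun j ↦ u j ω) k)‖ ^ 2 ∂P
        + h * descentError (Module.finrank ℝ E) L μ δ h := by
  have hS := hf.hasLipschitzGradient_smoothed hL μ
  have hgt := polyGrowth_of_isInexactOracle (hf.polyGrowth hL) ho
  have hXm := hu.aemeasurable_iter hft μ h x₀ k
  have hind := hu.indepFun_iter hft μ h x₀ k
  have hΦ := continuous_descentMajorant hf hL μ δ h
  have hz := integrable_one_add_norm_prodMk_pow
    (hu.integrable_one_add_norm_iter_pow hft hgt μ h x₀ k) hXm (hu.law k) hind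
  have hi := (polyGrowth_descentMajorant hf hL μ δ h).integrable
    (hΦ.measurable.comp_aemeasurable (hXm.prodMk (hu.law k).aemeasurable)).aestronglyMeasurable hz
  have hI := integral_comp_of_indepFun_stdGaussian hXm (hu.law k) hind hΦ hi
  have i0 := integrable_smoothed_iter (μ := μ) (h := h) hf hL ho hft hu x₀ k
  have i1 := integrable_norm_fderiv_iter_sq (μ := μ) (h := h) hf hL ho hft hu hS x₀ k
  have i2 : Integrable (fun ω ↦ smoothed f μ (iter ftil μ h x₀ (fun j ↦ u j ω) k)
      - 13 / 20 * h * ‖fderiv ℝ (smoothed f μ) (iter ftil μ h x₀ (fun j ↦ u j ω) k)‖ ^ 2) P :=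
    i0.sub (i1.const_mul _)
  calc _ ≤ ∫ ω, descentMajorant f L μ δ h (iter ftil μ h x₀ (fun j ↦ u j ω) k, u k ω) ∂P :=
        integral_mono (integrable_smoothed_iter hf hL ho hft hu x₀ (k + 1)) hi fun ω ↦
          smoothed_step_le_descentMajorant hf hL ho hμ hh _ _
    _ = _ := hI.2
    _ ≤ ∫ ω, (smoothed f μ (iter ftil μ h x₀ (fun j ↦ u j ω) k)
          - 13 / 20 * h * ‖fderiv ℝ (smoothed f μ) (iter ftil μ h x₀ (fun j ↦ u j ω) k)‖ ^ 2
          + h * descentError (Module.finrank ℝ E) L μ δ h) ∂P :=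
        integral_mono hI.1 (i2.add (integrable_const _)) fun ω ↦
          integral_descentMajorant_le hf hL hμ hh δ hLh _
    _ = _ := by
      rw [integral_add i2 (integrable_const _), integral_sub i0 (i1.const_mul _),
        integral_const_mul]
      simp

/-- Telescope the one-step inequality and bound the last value below by the infimum of `f`. If every
term exceeded the bound, so would the average. -/
theorem exists_integral_norm_fderiv_sq_le (hf : HasLipschitzGradient f L) (hL : 0 ≤ L)
    (hb : BddBelow (Set.range f))
    (ho : IsInexactOracle f ftil δ) (hft : Measurable ftil) (hu : IsIIDGaussian u P)
    (hμ : 0 < μ) (hh : 0 < h) (hLh : L * h * (Module.finrank ℝ E + 4) ≤ 1 / 40)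
    (x₀ : E) {N : ℕ} (hN : 1 ≤ N) :
    ∃ k < N, ∫ ω, ‖fderiv ℝ (smoothed f μ) (iter ftil μ h x₀ (fun j ↦ u j ω) k)‖ ^ 2 ∂P
      ≤ 20 / 13 * ((smoothed f μ x₀ - ⨅ x, f x) / (N * h)
        + descentError (Module.finrank ℝ E) L μ δ h) := by
  set G : ℕ → ℝ := fun k ↦
    ∫ ω, ‖fderiv ℝ (smoothed f μ) (iter ftil μ h x₀ (fun j ↦ u j ω) k)‖ ^ 2 ∂P with hG
  set F : ℕ → ℝ := fun k ↦ ∫ ω, smoothed f μ (iter ftil μ h x₀ (fun j ↦ u j ω) k) ∂P with hF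
  set b := descentError (Module.finrank ℝ E) L μ δ h with hbd
  have hN0 : (0 : ℝ) < N := by exact_mod_cast hN
  have hsum : ∀ M : ℕ, 13 / 20 * h * ∑ k ∈ Finset.range M, G k ≤ F 0 - F M + M * (h * b) := by
    intro M
    induction M with
    | zero => simp
    | succ M ih =>
      have := integral_smoothed_iter_succ_le hf hL ho hft hu hμ hh.le hLh x₀ M
      rw [Finset.sum_range_succ]
      push_cast
      change F (M + 1) ≤ F M - 13 / 20 * h * G M + h * b at this
      linarith
  have hF0 : F 0 = smoothed f μ x₀ := by simp [hF, iter]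
  have hFN : ⨅ x, f x ≤ F N := by
    calc ⨅ x, f x = ∫ _, ⨅ x, f x ∂P := by simp
      _ ≤ _ := integral_mono (integrable_const _)
        (integrable_smoothed_iter hf hL ho hft hu x₀ N) fun ω ↦ hf.iInf_le_smoothed hL hb μ _
  by_contra! hcon
  have hlt : ∑ _k ∈ Finset.range N, 20 / 13 * ((smoothed f μ x₀ - ⨅ x, f x) / (N * h) + b)
      < ∑ k ∈ Finset.range N, G k :=
    Finset.sum_lt_sum_of_nonempty (by simpa using Nat.one_le_iff_ne_zero.1 hN)
      fun k hk ↦ hcon k (Finset.mem_range.1 hk)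
  rw [Finset.sum_const, Finset.card_range, nsmul_eq_mul] at hlt
  have h1 := mul_lt_mul_of_pos_left hlt (by positivity : 0 < 13 / 20 * h)
  have e : 13 / 20 * h * (N * (20 / 13 * ((smoothed f μ x₀ - ⨅ x, f x) / (N * h) + b)))
      = (smoothed f μ x₀ - ⨅ x, f x) + N * (h * b) := by
    field_simp
  rw [e] at h1
  have := hsum N
  linarith

end Iteration

/-! ### Constants -/

/-- In the variables `w`, `s`, `t`, `Q` the claim splits into a gap term (`800/13 ≤ 160`), a noise
term absorbed through `(n + 4) / D ≥ 4`, and a smoothing term where `L ≤ A₁'` is used. -/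
theorem descent_le_gradBound {n L A₁' A₂' μ δ D gap N : ℝ} (hn : 0 ≤ n) (hL : 0 < L)
    (hA₁ : L ≤ A₁') (hD : 0 < D) (hD1 : D ≤ 1) (hgap : 0 ≤ gap) (hN : 0 < N) :
    20 / 13 * (gap / (N * stepSize n (L / 2) D) + descentError n L μ δ (stepSize n (L / 2) D))
      ≤ gradBound n L (L / 2) 0 A₁' A₂' μ δ D gap N := by
  set w := D / (n + 4) with hw
  set s := δ ^ 2 / μ ^ 2 with hs
  set t := L ^ 2 * μ ^ 2 with ht
  have hn4 : 0 < n + 4 := by linarith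
  have hw0 : 0 ≤ w := by positivity
  have hs0 : 0 ≤ s := by positivity
  have ht0 : 0 ≤ t := by positivity
  have hw1 : w ≤ 1 := by rw [hw, div_le_one hn4]; linarith
  set Q := (n + 4) * L * gap / (N * D) with hQ
  have hQ0 : 0 ≤ Q := by positivity
  have e1 : gap / (N * stepSize n (L / 2) D) = 40 * Q := by
    rw [hQ, stepSize]; field_simp; ring
  have e2 : descentError n L μ δ (stepSize n (L / 2) D)
      = 4 * s * n + w / 80 * (t * (n * (n + 2) * (n + 12)) + 8 * s * n) := by
    have : L * stepSize n (L / 2) D / 2 = w / 80 := by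
      rw [stepSize, hw]; field_simp
    rw [descentError, this, hs, ht]; ring
  have e3 : 320 * (n + 4) * (L / 2) / D * (0 + δ ^ 2 / (2 * (L / 2) * μ ^ 2) * n
      + δ ^ 2 / μ ^ 2 * n) = 160 * ((n + 4) / D) * (s * n) * (1 + L) := by
    rw [hs]; field_simp; ring
  have e4 : D / (4 * (n + 4)) * (4 * δ ^ 2 / μ ^ 2 * n + 4 * L ^ 2 / (1 + 1) ^ 2 * μ ^ 2 * n ^ 3
      + μ ^ 2 * A₁' ^ 2 / 4 * (n + 6) ^ 3 + A₂' ^ 2 / μ ^ 2 * n)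
      = w / 4 * (4 * s * n + t * n ^ 3 + μ ^ 2 * A₁' ^ 2 / 4 * (n + 6) ^ 3
        + A₂' ^ 2 / μ ^ 2 * n) := by
    rw [hs, ht, hw]; field_simp; ring
  have e5 : 320 * (n + 4) * (L / 2) * gap / (N * D) = 160 * Q := by rw [hQ]; ring
  rw [gradBound, e1, e2, e3, e4, e5]
  have b1 : t ≤ μ ^ 2 * A₁' ^ 2 := by
    rw [ht, mul_comm]; gcongr
  have b2 : t / 4 * (n + 6) ^ 3 ≤ μ ^ 2 * A₁' ^ 2 / 4 * (n + 6) ^ 3 := by gcongr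
  have b3 : 0 ≤ A₂' ^ 2 / μ ^ 2 * n := by positivity
  have b4 : 4 ≤ (n + 4) / D := by rw [le_div_iff₀ hD]; nlinarith
  have b5 : 160 * 4 * (s * n) * (1 + 0) ≤ 160 * ((n + 4) / D) * (s * n) * (1 + L) := by gcongr
  have b6 : w * (s * n) ≤ 1 * (s * n) := by gcongr
  have b7 : 20 / 13 * (1 / 80) * (n * (n + 2) * (n + 12)) ≤ 1 / 4 * (n ^ 3 + (n + 6) ^ 3 / 4) := by
    have : 0 ≤ n ^ 3 := by positivity
    linarith [sq_nonneg n]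
  have b8 := mul_le_mul_of_nonneg_left b7 (mul_nonneg hw0 ht0)
  have b9 := mul_le_mul_of_nonneg_left b2 hw0
  have b10 := mul_nonneg hw0 b3
  have b11 : 0 ≤ s * n := by positivity
  have b12 : 0 ≤ w * (s * n) := by positivity
  linarith

theorem stepSize_pos {n L D : ℝ} (hn : 0 ≤ n) (hL : 0 < L) (hD : 0 < D) :
    0 < stepSize n (L / 2) D := by
  unfold stepSize; positivity

theorem mul_stepSize_le {n L D : ℝ} (hn : 0 ≤ n) (hL : 0 < L) (hD1 : D ≤ 1) :
    L * stepSize n (L / 2) D * (n + 4) ≤ 1 / 40 := by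
  have e : L * stepSize n (L / 2) D * (n + 4) = D / 40 := by
    unfold stepSize; field_simp; ring
  rw [e]; gcongr

/-- The condition `μ² n² ≤ c ε` controls the cubic terms, divided by `n + 4`, and the smoothing part
of the gap, multiplied by `n`. The noise level is chosen so that `δ² n / μ² ≤ μ²`. -/
theorem gradBound_le {n L μ δ c C Δ ε gap N : ℝ} (hn : 1 ≤ n) (hL : 0 < L) (hμ : 0 < μ)
    (hc : 0 < c) (hcL : 8000 * (1 + L + L ^ 2) * c ≤ 1) (hC : 6400 * L * |Δ| ≤ C)
    (hε : 0 < ε) (hμn : μ ^ 2 ≤ c * ε / n ^ 2) (hδ0 : 0 ≤ δ) (hδ : δ ≤ μ ^ 2 / Real.sqrt n)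
    (hgap : gap ≤ Δ + L / 2 * μ ^ 2 * n) (hN1 : 1 ≤ N) (hN : C * n / ε ≤ N) :
    gradBound n L (L / 2) 0 L 0 μ δ 1 gap N ≤ ε / 4 := by
  have hn0 : 0 < n := by linarith
  have hN0 : 0 < N := by linarith
  have hμ1 : μ ^ 2 * n ^ 2 ≤ c * ε := by rwa [le_div_iff₀ (by positivity)] at hμn
  have hμ2 : μ ^ 2 * n ≤ c * ε := by
    refine le_trans ?_ hμ1
    have : n ≤ n ^ 2 := by nlinarith
    gcongr
  have hμ3 : μ ^ 2 ≤ c * ε := by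
    refine le_trans ?_ hμ2
    exact le_mul_of_one_le_right (by positivity) hn
  have hsn : δ ^ 2 / μ ^ 2 * n ≤ μ ^ 2 := by
    have h1 : δ ^ 2 ≤ (μ ^ 2 / Real.sqrt n) ^ 2 := by gcongr
    rw [div_pow, Real.sq_sqrt hn0.le, le_div_iff₀ hn0] at h1
    rw [div_mul_eq_mul_div, div_le_iff₀ (by positivity)]
    linarith
  have hsn0 : 0 ≤ δ ^ 2 / μ ^ 2 * n := by positivity
  have t1 : 320 * (n + 4) * (L / 2) * gap / (N * 1) ≤ ε / 8 + 400 * L ^ 2 * (c * ε) := by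
    have h1 : 320 * (n + 4) * (L / 2) * gap ≤ 320 * (5 * n) * (L / 2) * (|Δ| + L / 2 * μ ^ 2 * n) := by
      have h2 : gap ≤ |Δ| + L / 2 * μ ^ 2 * n := hgap.trans (by gcongr; exact le_abs_self Δ)
      have h3 : 0 ≤ |Δ| + L / 2 * μ ^ 2 * n := by positivity
      calc _ ≤ 320 * (n + 4) * (L / 2) * (|Δ| + L / 2 * μ ^ 2 * n) := by gcongr
        _ ≤ _ := by gcongr; linarith
    rw [mul_one, div_le_iff₀ hN0]
    refine h1.trans ?_
    have h4 : C * n ≤ N * ε := by rwa [div_le_iff₀ hε] at hN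
    -- From `n + 4 ≤ 5 n` the coefficient is `800 L |Δ| n`; the extra factor `8` makes this part at
    -- most `ε / 8`.
    have h5 : 6400 * L * |Δ| * n ≤ C * n := by gcongr
    have h6 : 400 * L ^ 2 * (μ ^ 2 * n ^ 2) ≤ 400 * L ^ 2 * (c * ε) := by gcongr
    have h7 : 400 * L ^ 2 * (c * ε) * 1 ≤ 400 * L ^ 2 * (c * ε) * N := by gcongr
    linarith
  have t2 : 1 / (4 * (n + 4)) * (4 * δ ^ 2 / μ ^ 2 * n + 4 * L ^ 2 / (1 + 1) ^ 2 * μ ^ 2 * n ^ 3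
      + μ ^ 2 * L ^ 2 / 4 * (n + 6) ^ 3 + 0 ^ 2 / μ ^ 2 * n) ≤ (1 + 23 * L ^ 2) * (c * ε) := by
    rw [div_mul_eq_mul_div, one_mul, div_le_iff₀ (by positivity)]
    have h1 : (n + 6) ^ 3 ≤ (7 * n) ^ 3 := by gcongr; linarith
    have h2 : μ ^ 2 * L ^ 2 / 4 * (n + 6) ^ 3 ≤ μ ^ 2 * L ^ 2 / 4 * (7 * n) ^ 3 := by gcongr
    have h3 : L ^ 2 * n * (μ ^ 2 * n ^ 2) ≤ L ^ 2 * n * (c * ε) := by gcongr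
    have h4 : 4 * δ ^ 2 / μ ^ 2 * n + 4 * L ^ 2 / (1 + 1) ^ 2 * μ ^ 2 * n ^ 3
        + μ ^ 2 * L ^ 2 / 4 * (n + 6) ^ 3 + 0 ^ 2 / μ ^ 2 * n
        = 4 * (δ ^ 2 / μ ^ 2 * n) + L ^ 2 * n * (μ ^ 2 * n ^ 2)
          + μ ^ 2 * L ^ 2 / 4 * (n + 6) ^ 3 := by ring
    have h9 : μ ^ 2 * L ^ 2 / 4 * (7 * n) ^ 3 = 343 / 4 * (L ^ 2 * n * (μ ^ 2 * n ^ 2)) := by ring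
    rw [h4]
    have h5 : 0 ≤ c * ε := by positivity
    have h6 : 0 ≤ L ^ 2 * (c * ε) := by positivity
    have h7 : 0 ≤ n * (c * ε) := by positivity
    have h8 : 0 ≤ L ^ 2 * n * (c * ε) := by positivity
    linarith
  have t3 : 320 * (n + 4) * (L / 2) / 1 * (0 + δ ^ 2 / (2 * (L / 2) * μ ^ 2) * n
      + δ ^ 2 / μ ^ 2 * n) ≤ 800 * (1 + L) * (c * ε) := by
    have e : 320 * (n + 4) * (L / 2) / 1 * (0 + δ ^ 2 / (2 * (L / 2) * μ ^ 2) * n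
      + δ ^ 2 / μ ^ 2 * n) = 160 * (n + 4) * (1 + L) * (δ ^ 2 / μ ^ 2 * n) := by
      field_simp; ring
    rw [e]
    calc _ ≤ 160 * (5 * n) * (1 + L) * μ ^ 2 := by gcongr; linarith
      _ = 800 * (1 + L) * (μ ^ 2 * n) := by ring
      _ ≤ _ := by gcongr
  -- The coefficients of `c ε` sum to `801 + 800 L + 423 L²`, so they contribute little more than `ε
  -- / 10`, within the `ε / 8` left.
  have t4 : 8000 * (1 + L + L ^ 2) * c * ε ≤ 1 * ε := by gcongr
  rw [gradBound]
  have h1 : 0 ≤ c * ε := by positivity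
  have h2 : 0 ≤ L * (c * ε) := by positivity
  have h3 : 0 ≤ L ^ 2 * (c * ε) := by positivity
  linarith

theorem sqrt_div_sq_div_sqrt {a n : ℝ} (ha : 0 ≤ a) (hn : 0 < n) :
    (Real.sqrt a / n) ^ 2 / Real.sqrt n = a / n ^ (5 / 2 : ℝ) := by
  have e : n ^ (5 / 2 : ℝ) = n ^ 2 * Real.sqrt n := by
    rw [Real.sqrt_eq_rpow, ← Real.rpow_natCast, ← Real.rpow_add hn]
    norm_num
  rw [div_pow, Real.sq_sqrt ha, e, div_div]

theorem IsInexactOracle.nonneg {E : Type*} [NormedAddCommGroup E] {f ftil : E → ℝ}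
    {δ : ℝ} (h : IsInexactOracle f ftil δ) : 0 ≤ δ :=
  (abs_nonneg _).trans (h 0)

/-! ### Bounds for the process in final form, and transfer from the smoothed gradient to the
original one. -/

section Iteration

variable {E : Type*} [NormedAddCommGroup E] [InnerProductSpace ℝ E] [FiniteDimensional ℝ E]
  [MeasurableSpace E] [BorelSpace E] {Ω : Type*} [MeasurableSpace Ω] {P : Measure Ω}
  [IsProbabilityMeasure P] {u : ℕ → Ω → E} {f ftil : E → ℝ} {L μ δ : ℝ}

theorem exists_integral_norm_fderiv_sq_le_gradBound (hf : HasLipschitzGradient f L) (hL : 0 < L)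
    (hb : BddBelow (Set.range f)) (ho : IsInexactOracle f ftil δ) (hft : Measurable ftil)
    (hu : IsIIDGaussian u P) (hμ : 0 < μ) {D A₁' : ℝ} (hD : 0 < D) (hD1 : D ≤ 1)
    (hA₁ : L ≤ A₁') (A₂' : ℝ) (x₀ : E) {N : ℕ} (hN : 1 ≤ N) :
    ∃ k < N, ∫ ω, ‖fderiv ℝ (smoothed f μ) (iter ftil μ
        (stepSize (Module.finrank ℝ E) (L / 2) D) x₀ (fun j ↦ u j ω) k)‖ ^ 2 ∂P
      ≤ gradBound (Module.finrank ℝ E) L (L / 2) 0 A₁' A₂' μ δ D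
        (smoothed f μ x₀ - ⨅ x, f x) N := by
  have hn : (0 : ℝ) ≤ Module.finrank ℝ E := Nat.cast_nonneg _
  obtain ⟨k, hk, h⟩ := exists_integral_norm_fderiv_sq_le hf hL.le hb ho hft hu hμ
    (stepSize_pos hn hL hD) (mul_stepSize_le hn hL hD1) x₀ hN
  exact ⟨k, hk, h.trans (descent_le_gradBound hn hL hA₁ hD hD1
    (sub_nonneg.2 (hf.iInf_le_smoothed hL.le hb μ x₀)) (by exact_mod_cast hN))⟩

theorem integral_norm_fderiv_sq_le (hf : HasLipschitzGradient f L) (hL : 0 ≤ L)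
    (ho : IsInexactOracle f ftil δ) (hft : Measurable ftil) (hu : IsIIDGaussian u P)
    (h : ℝ) (x₀ : E) (k : ℕ) :
    ∫ ω, ‖fderiv ℝ f (iter ftil μ h x₀ (fun j ↦ u j ω) k)‖ ^ 2 ∂P
      ≤ 2 * ∫ ω, ‖fderiv ℝ (smoothed f μ) (iter ftil μ h x₀ (fun j ↦ u j ω) k)‖ ^ 2 ∂P
        + 2 * (L ^ 2 * μ ^ 2 * Module.finrank ℝ E) := by
  have i1 := integrable_norm_fderiv_iter_sq (μ := μ) (h := h) hf hL ho hft hu hf x₀ k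
  have i2 := (integrable_norm_fderiv_iter_sq (μ := μ) (h := h) hf hL ho hft hu
    (hf.hasLipschitzGradient_smoothed hL μ) x₀ k).const_mul 2
  refine (integral_mono i1 (i2.add (integrable_const _)) fun ω ↦
    hf.norm_fderiv_sq_le hL μ _).trans_eq ?_
  simp only [Pi.add_apply]
  rw [integral_add i2 (integrable_const _), integral_const_mul]
  simp

end Iteration

end GaussianSmoothing

/-! ### Assembly of the three claims. -/

theorem mainTheorem4 (L : ℝ) (hL : 0 < L) :
    -- the gradient of the smoothed function is `L`-Lipschitz, with the quadratic bound it gives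
    (∀ (E : Type*) [NormedAddCommGroup E] [InnerProductSpace ℝ E] [FiniteDimensional ℝ E]
        [MeasurableSpace E] [BorelSpace E] (f : E → ℝ) (μ : ℝ),
      GaussianSmoothing.HasLipschitzGradient f L → 0 < μ →
        GaussianSmoothing.HasLipschitzGradient (GaussianSmoothing.smoothed f μ) L ∧
        ∀ x y : E,
          |GaussianSmoothing.smoothed f μ y - GaussianSmoothing.smoothed f μ x
            - fderiv ℝ (GaussianSmoothing.smoothed f μ) x (y - x)| ≤ L / 2 * ‖y - x‖ ^ 2) ∧
    -- the general bound holds with `A₁ = L / 2` and `A₂ = 0`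
    (∀ (E : Type*) [NormedAddCommGroup E] [InnerProductSpace ℝ E] [FiniteDimensional ℝ E]
        [MeasurableSpace E] [BorelSpace E] (Ω : Type*) [MeasurableSpace Ω]
        (P : Measure Ω) [IsProbabilityMeasure P] (u : ℕ → Ω → E)
        (f ftil : E → ℝ) (x₀ : E) (μ δ D A₁' A₂' : ℝ) (N : ℕ),
      GaussianSmoothing.HasLipschitzGradient f L → BddBelow (Set.range f) →
      GaussianSmoothing.IsInexactOracle f ftil δ → Measurable ftil →
      GaussianSmoothing.IsIIDGaussian u P →
      0 < μ → 0 < D → D ≤ 1 → L ≤ A₁' → 0 ≤ A₂' → 1 ≤ N →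
        let n : ℝ := Module.finrank ℝ E
        let X : ℕ → Ω → E := fun k ω =>
          GaussianSmoothing.iter ftil μ (GaussianSmoothing.stepSize n (L / 2) D) x₀
            (fun j => u j ω) k
        (∀ k, Integrable (fun ω => ‖fderiv ℝ (GaussianSmoothing.smoothed f μ) (X k ω)‖ ^ 2) P) ∧
        ∃ k < N, ∫ ω, ‖fderiv ℝ (GaussianSmoothing.smoothed f μ) (X k ω)‖ ^ 2 ∂P ≤
          GaussianSmoothing.gradBound n L (L / 2) 0 A₁' A₂' μ δ D
            (GaussianSmoothing.smoothed f μ x₀ - ⨅ x, f x) N) ∧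
    -- the complexity and the admissible noise level, for this choice and `D = 1`
    ∃ c : ℝ, 0 < c ∧ ∀ Δ : ℝ, ∃ C : ℝ, 0 < C ∧
      ∀ (E : Type*) [NormedAddCommGroup E] [InnerProductSpace ℝ E] [FiniteDimensional ℝ E]
        [Nontrivial E] [MeasurableSpace E] [BorelSpace E] (f : E → ℝ) (x₀ : E) (ε : ℝ),
      GaussianSmoothing.HasLipschitzGradient f L → BddBelow (Set.range f) →
      f x₀ - (⨅ x, f x) ≤ Δ → 0 < ε →
        let n : ℝ := Module.finrank ℝ E
        let μ₀ : ℝ := Real.sqrt (c * ε) / n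
        μ₀ ^ 2 / Real.sqrt n = c * ε / n ^ (5 / 2 : ℝ) ∧
        ∀ μ : ℝ, 0 < μ → μ ≤ μ₀ →
          (∀ x, |GaussianSmoothing.smoothed f μ x - f x| ≤ L / 2 * μ ^ 2 * n) ∧
          L / 2 * μ₀ ^ 2 * n = L * c / 2 * ε / n ∧
          ∀ (Ω : Type*) [MeasurableSpace Ω] (P : Measure Ω) [IsProbabilityMeasure P]
            (u : ℕ → Ω → E) (ftil : E → ℝ) (δ : ℝ) (N : ℕ),
          GaussianSmoothing.IsInexactOracle f ftil δ → Measurable ftil →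
          GaussianSmoothing.IsIIDGaussian u P →
          δ ≤ μ ^ 2 / Real.sqrt n → C * n / ε ≤ N →
            let X : ℕ → Ω → E := fun k ω =>
              GaussianSmoothing.iter ftil μ (GaussianSmoothing.stepSize n (L / 2) 1) x₀
                (fun j => u j ω) k
            ((∀ k, Integrable (fun ω => ‖fderiv ℝ f (X k ω)‖ ^ 2) P) ∧
              ∃ k < N, ∫ ω, ‖fderiv ℝ f (X k ω)‖ ^ 2 ∂P ≤ ε) ∧
            ((∀ k, Integrable
                (fun ω => ‖fderiv ℝ (GaussianSmoothing.smoothed f μ) (X k ω)‖ ^ 2) P) ∧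
              ∃ k < N,
                ∫ ω, ‖fderiv ℝ (GaussianSmoothing.smoothed f μ) (X k ω)‖ ^ 2 ∂P ≤ ε) := by
  open GaussianSmoothing in
  refine ⟨fun E _ _ _ _ _ f μ hf _ ↦ ⟨hf.hasLipschitzGradient_smoothed hL.le μ,
    (hf.hasLipschitzGradient_smoothed hL.le μ).abs_sub_sub_fderiv_le⟩, ?_,
    1 / (8000 * (1 + L + L ^ 2)), by positivity, fun Δ ↦ ⟨6400 * L * |Δ| + 1, by positivity, ?_⟩⟩
  · intro E _ _ _ _ _ Ω _ P _ u f ftil x₀ μ δ D A₁' A₂' N hf hb ho hft hu hμ hD hD1 hA₁ _ hN n X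
    exact ⟨fun k ↦ integrable_norm_fderiv_iter_sq hf hL.le ho hft hu
      (hf.hasLipschitzGradient_smoothed hL.le μ) x₀ k,
      exists_integral_norm_fderiv_sq_le_gradBound hf hL hb ho hft hu hμ hD hD1 hA₁ A₂' x₀ hN⟩
  · intro E _ _ _ _ _ _ f x₀ ε hf hb hΔ hε n μ₀
    set c := 1 / (8000 * (1 + L + L ^ 2)) with hcdef
    have hc : 0 < c := by positivity
    have hcL : 8000 * (1 + L + L ^ 2) * c = 1 := by rw [hcdef]; field_simp
    have hn : 1 ≤ n := Nat.one_le_cast.2 (Module.finrank_pos (R := ℝ) (M := E))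
    have hn0 : 0 < n := by linarith
    have hμ₀ : μ₀ ^ 2 = c * ε / n ^ 2 := by
      rw [div_pow, Real.sq_sqrt (by positivity)]
    refine ⟨sqrt_div_sq_div_sqrt (by positivity) hn0, fun μ hμ hμle ↦
      ⟨hf.abs_smoothed_sub_le hL.le μ, by rw [hμ₀]; field_simp, ?_⟩⟩
    intro Ω _ P _ u ftil δ N ho hft hu hδ hN X
    have hμn : μ ^ 2 ≤ c * ε / n ^ 2 := by rw [← hμ₀]; gcongr
    -- The summand `1` in `C` keeps `C n / ε` positive even when `Δ = 0`, which forces `N ≥ 1`.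
    have hN0 : (0 : ℝ) < N := lt_of_lt_of_le (by positivity) hN
    have hN1 : 1 ≤ N := by exact_mod_cast hN0
    have hgap : smoothed f μ x₀ - ⨅ x, f x ≤ Δ + L / 2 * μ ^ 2 * n := by
      have := le_of_abs_le (hf.abs_smoothed_sub_le hL.le μ x₀)
      linarith
    obtain ⟨k, hk, hG⟩ := exists_integral_norm_fderiv_sq_le_gradBound hf hL hb ho hft hu hμ
      one_pos le_rfl le_rfl 0 x₀ hN1
    have hG' := hG.trans (gradBound_le hn hL hμ hc hcL.le (by linarith) hε hμn
      ho.nonneg hδ hgap (by exact_mod_cast hN1) hN)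
    refine ⟨⟨fun k ↦ integrable_norm_fderiv_iter_sq hf hL.le ho hft hu hf x₀ k, k, hk, ?_⟩,
      fun k ↦ integrable_norm_fderiv_iter_sq hf hL.le ho hft hu
        (hf.hasLipschitzGradient_smoothed hL.le μ) x₀ k, k, hk, hG'.trans (by linarith)⟩
    -- The same index `k` serves both gradients: twice `ε / 4` plus a smoothing error of at most `ε
    -- / 4` stays below `ε`.
    refine (integral_norm_fderiv_sq_le hf hL.le ho hft hu _ x₀ k).trans ?_
    have h1 : μ ^ 2 * n ≤ c * ε := by
      rw [le_div_iff₀ (by positivity)] at hμn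
      refine le_trans ?_ hμn
      have : n ≤ n ^ 2 := by nlinarith
      gcongr
    have h2 : L ^ 2 * (μ ^ 2 * n) ≤ L ^ 2 * (c * ε) := by gcongr
    have h3 : 8000 * (1 + L + L ^ 2) * c * ε = ε := by rw [hcL, one_mul]
    have h4 : 0 ≤ c * ε := by positivity
    have h5 : 0 ≤ L * (c * ε) := by positivity
    have h6 : 2 * (L ^ 2 * μ ^ 2 * n) ≤ ε / 4 := by linarith
    linarith
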